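/- A metric space $(X,d)$ is called a Banakh space if for every point $c\in X$ and every real number $r$ in the distance set $d[X^2]=\{d(x,y):x,y\in X\}$ there exist points $x,y\in X$ such that $\{z\in X:d(z,c)=r\}=\{x,y\}$ and $d(x,y)=2r$. For sets $A,B\subseteq\mathbb R$ put $A+B=\{a+b:a\in A,\;b\in B\}$ and $\mathbb QB=\{qb:q\in\mathbb Q,\;b\in B\}$, and for $r\in\mathbb R$ put $\mathbb Qr=\{qr:q\in\mathbb Q\}$. A set $B\subseteq\mathbb R$ is a monoid if $0\in B=B+B$. A set $B\subseteq\mathbb R$ is floppy if every real number $r$ with $r=\inf\{a+b:a,b\in B,\;r=b-a\}$ belongs to $B$ (where $\inf\emptyset=+\infty$). For $M\subseteq[0,\infty)$ let $$\ddot M=\{r\in M\setminus\{0\}:x+y\ne r\text{ for all }x,y\in (M\cap\mathbb Qr)\setminus\{0,r\}\}.$$ Theorem. Let $M\subseteq[0,\infty)$ be a set satisfying the following conditions: (1) $|M|\le\omega_1$; (2) for every $r\in M$ the set $M_r=M\cap\mathbb Qr$ is a floppy monoid; (3) for every subset $B\subseteq M$ of cardinality $|B|<|M|$ the set $\ddot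 M\setminus(\mathbb QB+\mathbb QB)$ is dense in $[0,\infty)$. Then there exists a Banakh space $X$ with distance set $d[X^2]=M$. -/

import Mathlib

open scoped Pointwise

/-- The distance set `{d(x,y) : x, y ∈ X}` of a metric space. -/
def distanceSet (X : Type*) [MetricSpace X] : Set ℝ :=
  {r | ∃ x y : X, dist x y = r}

/-- A metric space is Banakh if every sphere `S(c;r)` with `c ∈ X` and `r` in the distance set
is of the form `{x, y}` with `d(x,y) = 2r`. -/
def IsBanakhSpace (X : Type*) [MetricSpace X] : Prop :=
  ∀ c : X, ∀ r ∈ distanceSet X, ∃ x y : X, Metric.sphere c r = {x, y} ∧ dist x y = 2 * r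

/-- The set `ℚB = {q b : q ∈ ℚ, b ∈ B}` for a set `B` of real numbers. -/
def ratMul (B : Set ℝ) : Set ℝ :=
  {x | ∃ q : ℚ, ∃ b ∈ B, x = (q : ℝ) * b}

/-- A set `M` of real numbers is a monoid if `0 ∈ M = M + M`. -/
def IsMonoidSet (M : Set ℝ) : Prop :=
  0 ∈ M ∧ M = M + M

/-- A set `B` of real numbers is floppy if every real number `r` that equals
`inf {a + b : a, b ∈ B, r = b - a}` belongs to `B`. The infimum is expressed by `IsGLB`,
so that no real number is the infimum of the empty set (whose infimum is `+∞`). -/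
def IsFloppySet (B : Set ℝ) : Prop :=
  ∀ r : ℝ, IsGLB {s | ∃ a ∈ B, ∃ b ∈ B, r = b - a ∧ s = a + b} r → r ∈ B

/-- The set of all `r ∈ B \ {0}` that are not the sum of two elements
of `(B ∩ ℚr) \ {0, r}`. -/
def indecomposables (B : Set ℝ) : Set ℝ :=
  {r | r ∈ B \ {0} ∧
    ∀ x ∈ (B ∩ ratMul {r}) \ {0, r}, ∀ y ∈ (B ∩ ratMul {r}) \ {0, r}, x + y ≠ r}

/-! The space is built by extending partial structures. In a floppy graph some pairs are frozen,
with final distances in `M`, while every other distance is strictly above the lower bound that the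
frozen ones force on it. A point with one frozen nonzero distance already has its complete two-point
spheres for all commensurable radii in `M`.

The building block is a line (`exists_line`): the differences of elements of `M ∩ ℚr`, frozen where
the Euclidean distance lies in `M`, with the metric `inf (a + b)` over representations of the
difference as `b - a`. Floppiness of `M ∩ ℚr` says exactly that this infimum exceeds the Euclidean
distance at unfrozen pairs. The sphere of radius `s` about `c` is `{c + s, c - s}`.

To freeze a pair, its distance is lowered to some `t ∈ M` still above the forced bound (`addEdge`),
and the line of `t` is glued along the pair (`glue`). Density lets `t` be incommensurable with all
frozen distances, so no old sphere acquires a third point. To give a point spheres of a new radius,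
a line is glued at that point alone.

Countably many such moves freeze all pairs of a countable graph (`Roomy.exists_full`). For countable
`M` this suffices. For `|M| = ω₁` one takes an increasing `ω₁`-sequence of countable, fully frozen
graphs: each has used only countably many distances, so density still applies, and stage `i`
supplies the radii with index at most `i`. -/

/-! ### Floppy graphs and freezing one more pair. -/

/-- A metric `ρ` on a set `V` together with a graph `E` of frozen pairs. It is floppy in the sense
that the distance of every non-adjacent pair can be decreased while the distances of adjacent
pairs are kept. -/
structure FloppyGraph (α : Type*) where
  V : Set α
  E : α → α → Prop
  ρ : α → α → ℝ
  mem_left : ∀ {u v}, E u v → u ∈ V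
  E_refl : ∀ {u}, u ∈ V → E u u
  E_symm : ∀ {u v}, E u v → E v u
  ρ_symm : ∀ {u v}, u ∈ V → v ∈ V → ρ u v = ρ v u
  ρ_self : ∀ {u}, u ∈ V → ρ u u = 0
  ρ_pos : ∀ {u v}, u ∈ V → v ∈ V → u ≠ v → 0 < ρ u v
  ρ_tri : ∀ {u v w}, u ∈ V → v ∈ V → w ∈ V → ρ u w ≤ ρ u v + ρ v w
  floppy : ∀ {u v}, u ∈ V → v ∈ V → ¬ E u v →
    ∃ c < ρ u v, ∀ p q, E p q → ρ p q ≤ ρ p u + ρ q v + c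

namespace FloppyGraph

variable {α : Type*}

theorem mem_right (S : FloppyGraph α) {u v : α} (h : S.E u v) : v ∈ S.V :=
  S.mem_left (S.E_symm h)

theorem ρ_nonneg (S : FloppyGraph α) {u v : α} (hu : u ∈ S.V) (hv : v ∈ S.V) : 0 ≤ S.ρ u v := by
  by_cases h : u = v
  · subst h; rw [S.ρ_self hu]
  · exact (S.ρ_pos hu hv h).le

/-- A lower bound for the possible distances that is strict for non-adjacent pairs. -/
theorem exists_lower (S : FloppyGraph α) {u v : α} (hu : u ∈ S.V) (hv : v ∈ S.V) :
    ∃ c ≤ S.ρ u v, (¬ S.E u v → c < S.ρ u v) ∧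
      ∀ p q, S.E p q → S.ρ p q ≤ S.ρ p u + S.ρ q v + c := by
  by_cases h : S.E u v
  · refine ⟨_, le_rfl, fun h' => absurd h h', fun p q hpq => ?_⟩
    have hp := S.mem_left hpq
    have hq := S.mem_right hpq
    have h1 := S.ρ_tri hp hu hq
    have h2 := S.ρ_tri hu hv hq
    rw [S.ρ_symm hv hq] at h2
    linarith
  · obtain ⟨c, hc, hc'⟩ := S.floppy hu hv h
    exact ⟨c, hc.le, fun _ => hc, hc'⟩

set_option maxHeartbeats 1600000 in
/-- The distance of a non-adjacent pair may be decreased slightly and then frozen. -/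
theorem addEdge (S : FloppyGraph α) {x y : α} (hx : x ∈ S.V) (hy : y ∈ S.V) {c t : ℝ}
    (hc : ∀ p q, S.E p q → S.ρ p q ≤ S.ρ p x + S.ρ q y + c) (hct : c < t) (ht : 0 < t)
    (hty : t < S.ρ x y) :
    ∃ T : FloppyGraph α, T.V = S.V ∧
      (∀ u v, T.E u v ↔ S.E u v ∨ (u = x ∧ v = y) ∨ (u = y ∧ v = x)) ∧
      (∀ u v, S.E u v → T.ρ u v = S.ρ u v) ∧ T.ρ x y = t ∧
      ∀ u ∈ S.V, u ≠ x → u ≠ y → t < T.ρ u x + T.ρ u y ∧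
        (S.E u y → T.ρ u y < T.ρ u x + t) ∧ (S.E u x → T.ρ u x < T.ρ u y + t) := by
  classical
  -- The path metric after adding an edge of length `t` between `x` and `y`; a shortest path uses
  -- that edge at most once.
  set d : α → α → ℝ := fun u v =>
    min (S.ρ u v) (min (S.ρ u x + t + S.ρ y v) (S.ρ u y + t + S.ρ x v)) with hd
  have dcases : ∀ u v, d u v = S.ρ u v ∨ d u v = S.ρ u x + t + S.ρ y v ∨
      d u v = S.ρ u y + t + S.ρ x v := by
    intro u v
    simp only [hd]
    rcases min_choice (S.ρ u v) (min (S.ρ u x + t + S.ρ y v) (S.ρ u y + t + S.ρ x v)) with h | h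
    · exact Or.inl h
    · rw [h]; exact Or.inr (min_choice _ _)
  have d1 : ∀ u v, d u v ≤ S.ρ u v := fun u v => min_le_left _ _
  have d2 : ∀ u v, d u v ≤ S.ρ u x + t + S.ρ y v :=
    fun u v => (min_le_right _ _).trans (min_le_left _ _)
  have d3 : ∀ u v, d u v ≤ S.ρ u y + t + S.ρ x v :=
    fun u v => (min_le_right _ _).trans (min_le_right _ _)
  have hn : ∀ {u v}, u ∈ S.V → v ∈ S.V → 0 ≤ S.ρ u v := fun hu hv => S.ρ_nonneg hu hv
  have hs : ∀ {u v}, u ∈ S.V → v ∈ S.V → S.ρ u v = S.ρ v u := fun hu hv => S.ρ_symm hu hv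
  have hxy := hs hx hy
  have dsymm : ∀ {u v}, u ∈ S.V → v ∈ S.V → d u v = d v u := by
    intro u v hu hv
    simp only [hd]
    rw [hs hu hv, hs hu hx, hs hu hy, hs hy hv, hs hx hv, min_comm (S.ρ x u + t + S.ρ v y)]
    congr 2 <;> ring
  have dtri : ∀ {u v w}, u ∈ S.V → v ∈ S.V → w ∈ S.V → d u w ≤ d u v + d v w := by
    intro u v w hu hv hw
    have a1 := d1 u w
    have a2 := d2 u w
    have a3 := d3 u w
    have b1 := S.ρ_tri hu hv hw
    have b2 := S.ρ_tri hu hv hx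
    have b3 := S.ρ_tri hu hv hy
    have b4 := S.ρ_tri hx hv hw
    have b5 := S.ρ_tri hy hv hw
    have b6 := S.ρ_tri hu hx hw
    have b7 := S.ρ_tri hu hy hw
    have c1 := hn hx hv
    have c2 := hn hy hv
    have c3 := hn hv hx
    have c4 := hn hv hy
    rcases dcases u v with h | h | h <;> rcases dcases v w with h' | h' | h' <;> rw [h, h'] <;>
      linarith
  -- A detour through the new edge cannot shorten an old edge, because `t` exceeds the forced bound
  -- `c`.
  have dE : ∀ u v, S.E u v → d u v = S.ρ u v := by
    intro u v huv
    have hu := S.mem_left huv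
    have hv := S.mem_right huv
    refine le_antisymm (d1 u v) ?_
    have e1 := hc _ _ huv
    have e2 := hc _ _ (S.E_symm huv)
    rw [hs hv hu, hs hv hx] at e2
    rw [hs hv hy] at e1
    rcases dcases u v with h | h | h <;> rw [h] <;> linarith
  have dpos : ∀ {u v}, u ∈ S.V → v ∈ S.V → u ≠ v → 0 < d u v := by
    intro u v hu hv huv
    have c0 := S.ρ_pos hu hv huv
    have c1 := hn hu hx
    have c2 := hn hu hy
    have c3 := hn hx hv
    have c4 := hn hy hv
    rcases dcases u v with h | h | h <;> rw [h] <;> linarith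
  have dxy : d x y = t := by
    have h2 := d2 x y
    rw [S.ρ_self hx, S.ρ_self hy] at h2
    refine le_antisymm (by linarith) ?_
    have c1 := hn hx hy
    rcases dcases x y with h | h | h <;> rw [h]
    · exact hty.le
    · rw [S.ρ_self hx, S.ρ_self hy]; linarith
    · linarith
  refine ⟨{ V := S.V
            E := fun u v => S.E u v ∨ (u = x ∧ v = y) ∨ (u = y ∧ v = x)
            ρ := d
            mem_left := ?_
            E_refl := fun hu => Or.inl (S.E_refl hu)
            E_symm := ?_
            ρ_symm := dsymm
            ρ_self := fun hu => (dE _ _ (S.E_refl hu)).trans (S.ρ_self hu)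
            ρ_pos := dpos
            ρ_tri := dtri
            floppy := ?_ }, rfl, fun _ _ => Iff.rfl, dE, dxy, ?_⟩
  · rintro u v (h | ⟨rfl, rfl⟩ | ⟨rfl, rfl⟩)
    exacts [S.mem_left h, hx, hy]
  · rintro u v (h | ⟨rfl, rfl⟩ | ⟨rfl, rfl⟩)
    exacts [Or.inl (S.E_symm h), Or.inr (Or.inr ⟨rfl, rfl⟩), Or.inr (Or.inl ⟨rfl, rfl⟩)]
  · intro u v hu hv huv
    simp only [not_or, not_and] at huv
    obtain ⟨hE, h1, h2⟩ := huv
    have huv' : u ≠ v := by rintro rfl; exact hE (S.E_refl hu)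
    obtain ⟨c0, hc0, hb0⟩ := S.floppy hu hv hE
    have tux := hs hu hx
    have tuy := hs hu hy
    have tvx := hs hv hx
    have tvy := hs hv hy
    have tuv := hs hu hv
    have n1 := hn hu hx
    have n2 := hn hu hy
    have n3 := hn hv hx
    have n4 := hn hv hy
    have n5 := S.ρ_pos hu hv huv'
    have r1 := S.ρ_tri hu hv hx
    have r2 := S.ρ_tri hu hv hy
    have r3 := S.ρ_tri hv hu hx
    have r4 := S.ρ_tri hv hu hy
    have r5 := S.ρ_tri hx hu hy
    have r6 := S.ρ_tri hx hv hy
    have r7 := S.ρ_tri hu hx hv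
    have r8 := S.ρ_tri hu hy hv
    -- The pair `u, v` is not the new edge in either orientation; this makes the bounds forced by
    -- the new edge strict.
    have z1 : 0 < S.ρ u x + S.ρ v y := by
      by_cases h : u = x
      · have := S.ρ_pos hv hy (fun h' => h1 h h'); linarith
      · have := S.ρ_pos hu hx h; linarith
    have z2 : 0 < S.ρ u y + S.ρ v x := by
      by_cases h : u = y
      · have := S.ρ_pos hv hx (fun h' => h2 h h'); linarith
      · have := S.ρ_pos hu hy h; linarith
    have m1 := min_le_left c0 (min (S.ρ u x + S.ρ v y + c) (S.ρ u y + S.ρ v x + c))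
    have m2 := (min_le_right c0 (min (S.ρ u x + S.ρ v y + c) (S.ρ u y + S.ρ v x + c))).trans
      (min_le_left _ _)
    have m3 := (min_le_right c0 (min (S.ρ u x + S.ρ v y + c) (S.ρ u y + S.ρ v x + c))).trans
      (min_le_right _ _)
    have m4 := min_le_left (S.ρ v x) (S.ρ v y + c)
    have m5 := min_le_right (S.ρ v x) (S.ρ v y + c)
    have m6 := min_le_left (S.ρ v y) (S.ρ v x + c)
    have m7 := min_le_right (S.ρ v y) (S.ρ v x + c)
    have m8 := min_le_left (S.ρ u x) (S.ρ u y + c)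
    have m9 := min_le_right (S.ρ u x) (S.ρ u y + c)
    have m10 := min_le_left (S.ρ u y) (S.ρ u x + c)
    have m11 := min_le_right (S.ρ u y) (S.ρ u x + c)
    -- One bound for each way in which paths from an edge `p q` to `u` and `v` can use the new edge:
    -- `k1` if neither does, `k2`–`k5` if exactly one does; `k6` and `k7` are for the new edge
    -- itself. Each minimum collects alternative valid bounds, so that one of them is below `d u v`
    -- whichever path realizes `d u v`. All eight are strictly below `d u v`, so any `e` slightly
    -- smaller than `d u v` works.
    obtain ⟨e, he, k0, k1, k2, k3, k4, k5, k6, k7⟩ : ∃ e < d u v, 0 ≤ e ∧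
        min c0 (min (S.ρ u x + S.ρ v y + c) (S.ρ u y + S.ρ v x + c)) ≤ e ∧
        min (S.ρ v x) (S.ρ v y + c) - t - S.ρ u y ≤ e ∧
        min (S.ρ v y) (S.ρ v x + c) - t - S.ρ u x ≤ e ∧
        min (S.ρ u x) (S.ρ u y + c) - t - S.ρ v y ≤ e ∧
        min (S.ρ u y) (S.ρ u x + c) - t - S.ρ v x ≤ e ∧
        t - S.ρ u x - S.ρ v y ≤ e ∧ t - S.ρ u y - S.ρ v x ≤ e := by
      have key : ∀ᶠ e in nhdsWithin (d u v) (Set.Iio (d u v)), e < d u v ∧ 0 ≤ e ∧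
        min c0 (min (S.ρ u x + S.ρ v y + c) (S.ρ u y + S.ρ v x + c)) ≤ e ∧
        min (S.ρ v x) (S.ρ v y + c) - t - S.ρ u y ≤ e ∧
        min (S.ρ v y) (S.ρ v x + c) - t - S.ρ u x ≤ e ∧
        min (S.ρ u x) (S.ρ u y + c) - t - S.ρ v y ≤ e ∧
        min (S.ρ u y) (S.ρ u x + c) - t - S.ρ v x ≤ e ∧
        t - S.ρ u x - S.ρ v y ≤ e ∧ t - S.ρ u y - S.ρ v x ≤ e := by
        have ev : ∀ a < d u v, ∀ᶠ e in nhdsWithin (d u v) (Set.Iio (d u v)), a ≤ e :=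
          fun a ha => ((eventually_gt_nhds ha).filter_mono nhdsWithin_le_nhds).mono fun _ h => h.le
        refine (eventually_nhdsWithin_of_forall fun _ h => h).and ?_
        refine (ev _ (dpos hu hv huv')).and ((ev _ ?_).and ((ev _ ?_).and ((ev _ ?_).and
          ((ev _ ?_).and ((ev _ ?_).and ((ev _ ?_).and (ev _ ?_))))))) <;>
        rcases dcases u v with h | h | h <;> rw [h] <;> linarith
      exact key.exists
    refine ⟨e, he, ?_⟩
    rintro p q (hpq | ⟨rfl, rfl⟩ | ⟨rfl, rfl⟩)
    · have hp := S.mem_left hpq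
      have hq := S.mem_right hpq
      have f1 := hb0 _ _ hpq
      have f2 := hc _ _ hpq
      have f3 := hc _ _ (S.E_symm hpq)
      have g0 := hs hp hq
      have g1 := S.ρ_tri hp hu hx
      have g2 := S.ρ_tri hp hu hy
      have g3 := S.ρ_tri hq hv hx
      have g4 := S.ρ_tri hq hv hy
      have g5 := S.ρ_tri hp hx hq
      have g6 := S.ρ_tri hp hy hq
      have g7 := S.ρ_tri hx hv hq
      have g8 := S.ρ_tri hy hv hq
      have g9 := S.ρ_tri hx hu hp
      have g10 := S.ρ_tri hy hu hp
      have g11 := hs hp hu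
      have g12 := hs hq hv
      have g13 := hs hp hx
      have g14 := hs hp hy
      have g15 := hs hq hx
      have g16 := hs hq hy
      rw [dE _ _ hpq]
      rcases dcases p u with h | h | h <;> rcases dcases q v with h' | h' | h' <;> rw [h, h']
      · rcases min_choice c0 (min (S.ρ u x + S.ρ v y + c) (S.ρ u y + S.ρ v x + c)) with w | w
        · linarith
        · rcases min_choice (S.ρ u x + S.ρ v y + c) (S.ρ u y + S.ρ v x + c) with w' | w' <;>
            rw [w, w'] at k1 <;> linarith
      · rcases min_choice (S.ρ u x) (S.ρ u y + c) with w | w <;> linarith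
      · rcases min_choice (S.ρ u y) (S.ρ u x + c) with w | w <;> linarith
      · rcases min_choice (S.ρ v x) (S.ρ v y + c) with w | w <;> linarith
      · linarith
      · linarith
      · rcases min_choice (S.ρ v y) (S.ρ v x + c) with w | w <;> linarith
      · linarith
      · linarith
    · rw [dxy]
      have y0 := S.ρ_self hx
      have y1 := S.ρ_self hy
      rcases dcases p u with h | h | h <;> rcases dcases q v with h' | h' | h' <;> rw [h, h'] <;>
        linarith
    · rw [dsymm hy hx, dxy]
      have y0 := S.ρ_self hx
      have y1 := S.ρ_self hy
      rcases dcases p u with h | h | h <;> rcases dcases q v with h' | h' | h' <;> rw [h, h'] <;>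
        linarith
  -- Triangles over the new edge are nondegenerate: the side `x y` by `t < ρ x y`, the other frozen
  -- sides by `c < t`. `glue` needs this.
  · intro u hu hux huy
    have y0 := S.ρ_self hx
    have y1 := S.ρ_self hy
    have y2 := S.ρ_pos hu hx hux
    have y3 := S.ρ_pos hu hy huy
    have y4 := hs hu hx
    have y5 := hs hu hy
    have r1 := S.ρ_tri hx hu hy
    refine ⟨?_, fun h => ?_, fun h => ?_⟩
    · rcases dcases u x with h | h | h <;> rcases dcases u y with h' | h' | h' <;>
        (dsimp only; rw [h, h']; linarith)
    · have f1 := hc _ _ h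
      have f2 := hc _ _ (S.E_symm h)
      rcases dcases u x with h' | h' | h' <;> (dsimp only; rw [h', dE _ _ h]; linarith)
    · have f1 := hc _ _ h
      have f2 := hc _ _ (S.E_symm h)
      rcases dcases u y with h' | h' | h' <;> (dsimp only; rw [h', dE _ _ h]; linarith)

end FloppyGraph

/-! ### Amalgamation along a frozen pair or a point. -/

namespace FloppyGraph

variable {α : Type*}

/-- `d` is the amalgam of the metrics of `S` and `T` along a common clique `A`. -/
structure IsAmalgam (S T : FloppyGraph α) (A : Set α) (d : α → α → ℝ) : Prop where
  sub_left : A ⊆ S.V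
  sub_right : A ⊆ T.V
  adj_left : ∀ a ∈ A, ∀ b ∈ A, S.E a b
  adj_right : ∀ a ∈ A, ∀ b ∈ A, T.E a b
  left : ∀ {u v}, u ∈ S.V → v ∈ S.V → d u v = S.ρ u v
  right : ∀ {u v}, u ∈ T.V → v ∈ T.V → d u v = T.ρ u v
  symm : ∀ u v, d u v = d v u
  le : ∀ {u v a}, u ∈ S.V → v ∈ T.V → a ∈ A → d u v ≤ S.ρ u a + T.ρ a v
  exists_eq : ∀ {u v}, u ∈ S.V → v ∈ T.V → ∃ a ∈ A, d u v = S.ρ u a + T.ρ a v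

namespace IsAmalgam

variable {S T : FloppyGraph α} {A : Set α} {d : α → α → ℝ}

theorem swap (h : IsAmalgam S T A d) : IsAmalgam T S A d where
  sub_left := h.sub_right
  sub_right := h.sub_left
  adj_left := h.adj_right
  adj_right := h.adj_left
  left := h.right
  right := h.left
  symm := h.symm
  le := by
    intro u v a hu hv ha
    have := h.le hv hu ha
    rw [h.symm, S.ρ_symm (h.sub_left ha) hv, T.ρ_symm hu (h.sub_right ha)]
    linarith
  exists_eq := by
    intro u v hu hv
    obtain ⟨a, ha, e⟩ := h.exists_eq hv hu
    refine ⟨a, ha, ?_⟩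
    rw [h.symm, e, S.ρ_symm (h.sub_left ha) hv, T.ρ_symm hu (h.sub_right ha)]
    ring

theorem eq_on (h : IsAmalgam S T A d) {a b : α} (ha : a ∈ A) (hb : b ∈ A) :
    S.ρ a b = T.ρ a b := by
  rw [← h.left (h.sub_left ha) (h.sub_left hb), h.right (h.sub_right ha) (h.sub_right hb)]

theorem tri_left (h : IsAmalgam S T A d) {u v w : α} (hu : u ∈ S.V) (hv : v ∈ S.V)
    (hw : w ∈ S.V ∪ T.V) : d u w ≤ d u v + d v w := by
  rw [h.left hu hv]
  rcases hw with hw | hw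
  · rw [h.left hv hw, h.left hu hw]
    exact S.ρ_tri hu hv hw
  · obtain ⟨a, ha, e⟩ := h.exists_eq hv hw
    have h1 := h.le hu hw ha
    have h2 := S.ρ_tri hu hv (h.sub_left ha)
    rw [e]; linarith

theorem tri_cross (h : IsAmalgam S T A d) {u v w : α} (hu : u ∈ S.V) (hv : v ∈ T.V)
    (hw : w ∈ S.V) : d u w ≤ d u v + d v w := by
  rw [h.symm v w, h.left hu hw]
  obtain ⟨a, ha, e⟩ := h.exists_eq hu hv
  obtain ⟨b, hb, f⟩ := h.exists_eq hw hv
  have h1 := S.ρ_tri hu (h.sub_left ha) hw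
  have h2 := S.ρ_tri (h.sub_left ha) (h.sub_left hb) hw
  have h3 := T.ρ_tri (h.sub_right ha) hv (h.sub_right hb)
  have h4 := h.eq_on ha hb
  rw [S.ρ_symm (h.sub_left hb) hw] at h2
  rw [T.ρ_symm hv (h.sub_right hb)] at h3
  rw [e, f]; linarith

theorem tri (h : IsAmalgam S T A d) {u v w : α} (hu : u ∈ S.V ∪ T.V) (hv : v ∈ S.V ∪ T.V)
    (hw : w ∈ S.V ∪ T.V) : d u w ≤ d u v + d v w := by
  have key : ∀ {S T : FloppyGraph α}, IsAmalgam S T A d → ∀ {u v w : α}, u ∈ S.V →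
      v ∈ S.V ∪ T.V → w ∈ S.V ∪ T.V → d u w ≤ d u v + d v w := by
    intro S T h u v w hu hv hw
    rcases hv with hv | hv
    · exact h.tri_left hu hv hw
    · rcases hw with hw | hw
      · exact h.tri_cross hu hv hw
      · have := h.swap.tri_left hw hv (Or.inr hu)
        rw [h.symm w u, h.symm w v, h.symm v u] at this
        linarith
  rcases hu with hu | hu
  · exact key h hu hv hw
  · exact key h.swap hu (Set.union_comm _ _ ▸ hv) (Set.union_comm _ _ ▸ hw)

/-- An edge of `T` forces nothing new inside `S`: paths from its ends to `u` and `v` enter `S` at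
points `a, b` of the clique `A`, and `a b` is an edge of `S`, to which the bound applies. -/
theorem lower_left (h : IsAmalgam S T A d) {u v : α} (hu : u ∈ S.V) (hv : v ∈ S.V)
    {c : ℝ} (hc : ∀ p q, S.E p q → S.ρ p q ≤ S.ρ p u + S.ρ q v + c) {p q : α}
    (hpq : S.E p q ∨ T.E p q) : d p q ≤ d p u + d q v + c := by
  rcases hpq with hpq | hpq
  · have hp := S.mem_left hpq
    have hq := S.mem_right hpq
    rw [h.left hp hq, h.left hp hu, h.left hq hv]
    exact hc _ _ hpq
  · have hp := T.mem_left hpq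
    have hq := T.mem_right hpq
    obtain ⟨a, ha, e⟩ := h.swap.exists_eq hp hu
    obtain ⟨b, hb, f⟩ := h.swap.exists_eq hq hv
    have h1 := T.ρ_tri hp (h.sub_right ha) hq
    have h2 := T.ρ_tri (h.sub_right ha) (h.sub_right hb) hq
    have h3 := hc _ _ (h.adj_left a ha b hb)
    rw [h.eq_on ha hb] at h3
    rw [T.ρ_symm (h.sub_right hb) hq] at h2
    rw [h.right hp hq, e, f]
    linarith

end IsAmalgam

theorem IsAmalgam.pos_cross {S T : FloppyGraph α} {A : Set α} {d : α → α → ℝ}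
    (h : IsAmalgam S T A d) {u v : α} (hu : u ∈ S.V) (hv : v ∈ T.V) (huv : u ≠ v) :
    0 < d u v := by
  obtain ⟨a, ha, e⟩ := h.exists_eq hu hv
  have h1 := S.ρ_nonneg hu (h.sub_left ha)
  have h2 := T.ρ_nonneg (h.sub_right ha) hv
  rw [e]
  by_cases hua : u = a
  · subst hua
    have := T.ρ_pos (h.sub_right ha) hv huv
    linarith
  · have := S.ρ_pos hu (h.sub_left ha) hua
    linarith

/-- Edges of either side bound `d u v` through `x` or through `y`, which gives four constants; the
largest one works. Nondegenerate triangles over `x y` are required only in `S`, since the line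
playing the role of `T` has degenerate ones. -/
theorem IsAmalgam.lower_cross {S T : FloppyGraph α} {x y : α} {d : α → α → ℝ}
    (h : IsAmalgam S T {x, y} d)
    (hst : ∀ u ∈ S.V, u ≠ x → u ≠ y → S.ρ x y < S.ρ u x + S.ρ u y ∧
      (x ≠ y → S.E u y → S.ρ u y < S.ρ u x + S.ρ x y) ∧
      (x ≠ y → S.E u x → S.ρ u x < S.ρ u y + S.ρ x y))
    {u v : α} (hu : u ∈ S.V) (hv : v ∈ T.V) (hux : u ≠ x) (huy : u ≠ y) (hvx : v ≠ x)
    (hvy : v ≠ y) :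
    ∃ c < d u v, ∀ p q, S.E p q ∨ T.E p q → d p q ≤ d p u + d q v + c := by
  have hxA : x ∈ ({x, y} : Set α) := by simp
  have hyA : y ∈ ({x, y} : Set α) := by simp
  have hx := h.sub_left hxA
  have hy := h.sub_left hyA
  have hx' := h.sub_right hxA
  have hy' := h.sub_right hyA
  obtain ⟨s0, s1, s2⟩ := hst u hu hux huy
  have exy := h.eq_on hxA hyA
  have p1 := S.ρ_pos hu hx hux
  have p2 := S.ρ_pos hu hy huy
  have p3 := T.ρ_pos hx' hv hvx.symm
  have p4 := T.ρ_pos hy' hv hvy.symm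
  have t1 := S.ρ_tri hu hx hy
  have t2 := S.ρ_tri hu hy hx
  have t3 := T.ρ_tri hx' hv hy'
  have t4 := T.ρ_tri hx' hy' hv
  have t5 := T.ρ_tri hy' hx' hv
  rw [T.ρ_symm hv hy'] at t3
  rw [S.ρ_symm hy hx] at t2
  rw [T.ρ_symm hy' hx'] at t5
  have low : ∀ a ∈ ({x, y} : Set α), ∃ c < d u v, ∀ p q, S.E p q →
      S.ρ p q ≤ S.ρ p u + S.ρ q a + T.ρ a v + c := by
    intro a ha
    obtain ⟨c, hc, hc', hb⟩ := S.exists_lower hu (h.sub_left ha)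
    refine ⟨c - T.ρ a v, ?_, fun p q hpq => by linarith [hb p q hpq]⟩
    obtain ⟨b, hb, e⟩ := h.exists_eq hu hv
    rw [e]
    by_cases hab : a = b
    · subst hab
      rcases ha with rfl | rfl <;> linarith
    -- If `u a` is frozen, strictness comes from the nondegenerate triangle `u, x, y`; otherwise
    -- from floppiness of `u a`.
    · have key : c < S.ρ u b + S.ρ x y := by
        rcases ha with rfl | rfl <;> rcases hb with rfl | rfl
        · exact absurd rfl hab
        · by_cases hE : S.E u a
          · linarith [s2 hab hE]
          · linarith [hc' hE]
        · by_cases hE : S.E u a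
          · linarith [s1 (Ne.symm hab) hE]
          · linarith [hc' hE]
        · exact absurd rfl hab
      have : S.ρ x y ≤ T.ρ a v + T.ρ b v := by
        rcases ha with rfl | rfl <;> rcases hb with rfl | rfl
        · exact absurd rfl hab
        · linarith
        · linarith
        · exact absurd rfl hab
      linarith
  have low' : ∀ a ∈ ({x, y} : Set α), ∃ c < d u v, ∀ p q, T.E p q →
      T.ρ p q ≤ T.ρ p a + S.ρ a u + T.ρ q v + c := by
    intro a ha
    obtain ⟨c, hc, -, hb⟩ := T.exists_lower (h.sub_right ha) hv
    refine ⟨c - S.ρ a u, ?_, fun p q hpq => by linarith [hb p q hpq]⟩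
    rw [S.ρ_symm (h.sub_left ha) hu]
    obtain ⟨b, hb, e⟩ := h.exists_eq hu hv
    rw [e]
    rcases ha with rfl | rfl <;> rcases hb with rfl | rfl <;> linarith
  obtain ⟨c1, l1, b1⟩ := low x hxA
  obtain ⟨c2, l2, b2⟩ := low y hyA
  obtain ⟨c3, l3, b3⟩ := low' x hxA
  obtain ⟨c4, l4, b4⟩ := low' y hyA
  refine ⟨max (max c1 c2) (max c3 c4), max_lt (max_lt l1 l2) (max_lt l3 l4), ?_⟩
  have m1 : c1 ≤ max (max c1 c2) (max c3 c4) := by simp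
  have m2 : c2 ≤ max (max c1 c2) (max c3 c4) := by simp
  have m3 : c3 ≤ max (max c1 c2) (max c3 c4) := by simp
  have m4 : c4 ≤ max (max c1 c2) (max c3 c4) := by simp
  rintro p q (hpq | hpq)
  · have hp := S.mem_left hpq
    have hq := S.mem_right hpq
    obtain ⟨a, ha, e⟩ := h.exists_eq hq hv
    have f1 := b1 _ _ hpq
    have f2 := b2 _ _ hpq
    rw [h.left hp hq, h.left hp hu, e]
    rcases ha with rfl | rfl <;> linarith
  · have hp := T.mem_left hpq
    have hq := T.mem_right hpq
    obtain ⟨a, ha, e⟩ := h.swap.exists_eq hp hu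
    have f1 := b3 _ _ hpq
    have f2 := b4 _ _ hpq
    rw [h.right hp hq, h.right hq hv, e]
    rcases ha with rfl | rfl <;> linarith

theorem exists_isAmalgam (S T : FloppyGraph α) {x y : α} (hV : S.V ∩ T.V = {x, y})
    (hE : S.E x y) (hE' : T.E x y) (hρ : S.ρ x y = T.ρ x y) :
    ∃ d, IsAmalgam S T {x, y} d := by
  classical
  have hx := S.mem_left hE
  have hy := S.mem_right hE
  have hx' := T.mem_left hE'
  have hy' := T.mem_right hE'
  have sub : ∀ {u}, u ∈ S.V → u ∈ T.V → u = x ∨ u = y := by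
    intro u h1 h2
    have : u ∈ S.V ∩ T.V := ⟨h1, h2⟩
    rw [hV] at this
    exact this
  set e : α → α → ℝ := fun u v => min (S.ρ u x + T.ρ x v) (S.ρ u y + T.ρ y v) with he
  have ee : ∀ u v, ∃ a ∈ ({x, y} : Set α), e u v = S.ρ u a + T.ρ a v := by
    intro u v
    rcases min_choice (S.ρ u x + T.ρ x v) (S.ρ u y + T.ρ y v) with h | h
    · exact ⟨x, by simp, h⟩
    · exact ⟨y, by simp, h⟩
  have el : ∀ u v a, a ∈ ({x, y} : Set α) → e u v ≤ S.ρ u a + T.ρ a v := by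
    rintro u v a (rfl | rfl)
    · exact min_le_left _ _
    · exact min_le_right _ _
  have hA : ∀ a ∈ ({x, y} : Set α), ∀ b ∈ ({x, y} : Set α),
      S.E a b ∧ T.E a b ∧ S.ρ a b = T.ρ a b := by
    have hs : S.ρ y x = T.ρ y x := by rw [S.ρ_symm hy hx, T.ρ_symm hy' hx', hρ]
    have hx0 : S.ρ x x = T.ρ x x := by rw [S.ρ_self hx, T.ρ_self hx']
    have hy0 : S.ρ y y = T.ρ y y := by rw [S.ρ_self hy, T.ρ_self hy']
    rintro a (rfl | rfl) b (rfl | rfl)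
    exacts [⟨S.E_refl hx, T.E_refl hx', hx0⟩, ⟨hE, hE', hρ⟩,
      ⟨S.E_symm hE, T.E_symm hE', hs⟩, ⟨S.E_refl hy, T.E_refl hy', hy0⟩]
  have hAV : ∀ a ∈ ({x, y} : Set α), a ∈ S.V ∧ a ∈ T.V :=
    fun a ha => ⟨S.mem_left (hA a ha a ha).1, T.mem_left (hA a ha a ha).2.1⟩
  have eS : ∀ {u v}, u ∈ S.V → v ∈ ({x, y} : Set α) → e u v = S.ρ u v := by
    intro u v hu hv
    apply le_antisymm
    · have := el u v v hv
      rwa [T.ρ_self (hAV v hv).2, add_zero] at this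
    · obtain ⟨a, ha, h⟩ := ee u v
      rw [h, ← (hA a ha v hv).2.2]
      exact S.ρ_tri hu (hAV a ha).1 (hAV v hv).1
  have eT : ∀ {u v}, u ∈ ({x, y} : Set α) → v ∈ T.V → e u v = T.ρ u v := by
    intro u v hu hv
    apply le_antisymm
    · have := el u v u hu
      rwa [S.ρ_self (hAV u hu).1, zero_add] at this
    · obtain ⟨a, ha, h⟩ := ee u v
      rw [h, (hA u hu a ha).2.2]
      exact T.ρ_tri (hAV u hu).2 (hAV a ha).2 hv
  have sub' : ∀ {u}, u ∈ S.V → u ∈ T.V → u ∈ ({x, y} : Set α) := fun h1 h2 => sub h1 h2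
  -- Averaging makes `d` symmetric by its formula; on vertices it changes nothing. The value `0`
  -- occurs only for pairs not inside the union.
  set d : α → α → ℝ := fun u v =>
    if u ∈ S.V ∧ v ∈ S.V then (S.ρ u v + S.ρ v u) / 2 else
    if u ∈ T.V ∧ v ∈ T.V then (T.ρ u v + T.ρ v u) / 2 else
    if u ∈ S.V ∧ v ∈ T.V then e u v else if v ∈ S.V ∧ u ∈ T.V then e v u else 0 with hd
  have dS : ∀ {u v}, u ∈ S.V → v ∈ S.V → d u v = S.ρ u v := by
    intro u v hu hv
    simp only [hd, hu, hv, and_self, if_true]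
    rw [S.ρ_symm hv hu]; ring
  have dT : ∀ {u v}, u ∈ T.V → v ∈ T.V → d u v = T.ρ u v := by
    intro u v hu hv
    by_cases h : u ∈ S.V ∧ v ∈ S.V
    · rw [dS h.1 h.2, (hA u (sub' h.1 hu) v (sub' h.2 hv)).2.2]
    · simp only [hd, h, hu, hv, and_self, if_true, if_false]
      rw [T.ρ_symm hv hu]; ring
  have dST : ∀ {u v}, u ∈ S.V → v ∈ T.V → d u v = e u v := by
    intro u v hu hv
    by_cases h : v ∈ S.V
    · rw [dS hu h, eS hu (sub' h hv)]
    · by_cases h' : u ∈ T.V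
      · rw [dT h' hv, eT (sub' hu h') hv]
      · simp [hd, hu, hv, h, h']
  refine ⟨d, fun a ha => (hAV a ha).1, fun a ha => (hAV a ha).2,
    fun a ha b hb => (hA a ha b hb).1, fun a ha b hb => (hA a ha b hb).2.1, dS, dT, ?_, ?_, ?_⟩
  · intro u v
    by_cases h1 : u ∈ S.V <;> by_cases h2 : v ∈ S.V <;> by_cases h3 : u ∈ T.V <;>
      by_cases h4 : v ∈ T.V <;> simp [hd, h1, h2, h3, h4, add_comm]
  · intro u v a hu hv ha
    rw [dST hu hv]
    exact el u v a ha
  · intro u v hu hv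
    rw [dST hu hv]
    exact ee u v

/-- Amalgamation of two floppy graphs along a common edge or vertex. -/
theorem glue (S T : FloppyGraph α) {x y : α} (hV : S.V ∩ T.V = {x, y})
    (hE : S.E x y) (hE' : T.E x y) (hρ : S.ρ x y = T.ρ x y)
    (hst : ∀ u ∈ S.V, u ≠ x → u ≠ y → S.ρ x y < S.ρ u x + S.ρ u y ∧
      (x ≠ y → S.E u y → S.ρ u y < S.ρ u x + S.ρ x y) ∧
      (x ≠ y → S.E u x → S.ρ u x < S.ρ u y + S.ρ x y)) :
    ∃ U : FloppyGraph α, U.V = S.V ∪ T.V ∧ (∀ u v, U.E u v ↔ S.E u v ∨ T.E u v) ∧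
      (∀ u v, S.E u v → U.ρ u v = S.ρ u v) ∧ (∀ u v, T.E u v → U.ρ u v = T.ρ u v) := by
  obtain ⟨d, h⟩ := exists_isAmalgam S T hV hE hE' hρ
  refine ⟨{ V := S.V ∪ T.V
            E := fun u v => S.E u v ∨ T.E u v
            ρ := d
            mem_left := fun huv => huv.imp S.mem_left T.mem_left
            E_refl := fun hu => hu.imp S.E_refl T.E_refl
            E_symm := fun huv => huv.imp S.E_symm T.E_symm
            ρ_symm := fun _ _ => h.symm _ _
            ρ_self := ?_
            ρ_pos := ?_
            ρ_tri := h.tri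
            floppy := ?_ }, rfl, fun _ _ => Iff.rfl,
            fun u v huv => h.left (S.mem_left huv) (S.mem_right huv),
            fun u v huv => h.right (T.mem_left huv) (T.mem_right huv)⟩
  · rintro u (hu | hu)
    · rw [h.left hu hu, S.ρ_self hu]
    · rw [h.right hu hu, T.ρ_self hu]
  · rintro u v (hu | hu) (hv | hv) huv
    · rw [h.left hu hv]; exact S.ρ_pos hu hv huv
    · exact h.pos_cross hu hv huv
    · exact h.swap.pos_cross hu hv huv
    · rw [h.right hu hv]; exact T.ρ_pos hu hv huv
  · have left : ∀ {S T : FloppyGraph α}, IsAmalgam S T {x, y} d → ∀ {u v : α}, u ∈ S.V →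
        v ∈ S.V → ¬ S.E u v → ∃ c < d u v, ∀ p q, S.E p q ∨ T.E p q →
          d p q ≤ d p u + d q v + c := by
      intro S T h u v hu hv huv
      obtain ⟨c, hc, hb⟩ := S.floppy hu hv huv
      exact ⟨c, by rwa [h.left hu hv], fun p q hpq => h.lower_left hu hv hb hpq⟩
    have cross : ∀ {u v : α}, u ∈ S.V → v ∈ T.V → ¬ S.E u v → ¬ T.E u v →
        ∃ c < d u v, ∀ p q, S.E p q ∨ T.E p q → d p q ≤ d p u + d q v + c := by
      intro u v hu hv h1 h2
      by_cases hvS : v ∈ S.V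
      · exact left h hu hvS h1
      by_cases huT : u ∈ T.V
      · obtain ⟨c, hc, hb⟩ := left h.swap huT hv h2
        exact ⟨c, hc, fun p q hpq => hb p q hpq.symm⟩
      have hxA : x ∈ ({x, y} : Set α) := by simp
      have hyA : y ∈ ({x, y} : Set α) := by simp
      exact h.lower_cross hst hu hv (fun e => huT (e ▸ h.sub_right hxA))
        (fun e => huT (e ▸ h.sub_right hyA)) (fun e => hvS (e ▸ h.sub_left hxA))
        (fun e => hvS (e ▸ h.sub_left hyA))
    rintro u v (hu | hu) (hv | hv) huv <;> rw [not_or] at huv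
    · exact left h hu hv huv.1
    · exact cross hu hv huv.1 huv.2
    · obtain ⟨c, hc, hb⟩ := cross hv hu (fun e => huv.1 (S.E_symm e)) (fun e => huv.2 (T.E_symm e))
      refine ⟨c, by rwa [h.symm], fun p q hpq => ?_⟩
      have := hb q p (hpq.imp S.E_symm T.E_symm)
      rw [h.symm]; linarith
    · obtain ⟨c, hc, hb⟩ := left h.swap hu hv huv.2
      exact ⟨c, hc, fun p q hpq => hb p q hpq.symm⟩

end FloppyGraph

/-! ### Commensurability. -/

theorem mem_ratMul_singleton {r s : ℝ} : s ∈ ratMul {r} ↔ ∃ q : ℚ, s = q * r := by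
  simp [ratMul]

theorem mem_ratMul_self (r : ℝ) : r ∈ ratMul {r} :=
  mem_ratMul_singleton.2 ⟨1, by simp⟩

theorem ratMul_trans {B : Set ℝ} {r s : ℝ} (hs : s ∈ ratMul {r}) (hr : r ∈ ratMul B) :
    s ∈ ratMul B := by
  obtain ⟨q, rfl⟩ := mem_ratMul_singleton.1 hs
  obtain ⟨q', b, hb, rfl⟩ := hr
  exact ⟨q * q', b, hb, by push_cast; ring⟩

theorem ratMul_symm {r s : ℝ} (hs : s ∈ ratMul {r}) (h0 : s ≠ 0) : r ∈ ratMul {s} := by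
  obtain ⟨q, rfl⟩ := mem_ratMul_singleton.1 hs
  have hq : (q : ℝ) ≠ 0 := fun h => h0 (by simp [h])
  exact mem_ratMul_singleton.2 ⟨q⁻¹, by push_cast; field_simp⟩

theorem ratMul_mono {B C : Set ℝ} (h : B ⊆ C) : ratMul B ⊆ ratMul C := by
  rintro x ⟨q, b, hb, rfl⟩
  exact ⟨q, b, h hb, rfl⟩

theorem countable_ratMul_singleton (r : ℝ) : (ratMul {r}).Countable := by
  refine (Set.countable_range fun q : ℚ => (q : ℝ) * r).mono fun x hx => ?_
  obtain ⟨q, rfl⟩ := mem_ratMul_singleton.1 hx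
  exact ⟨q, rfl⟩

/-! ### Transport, and graphs with two-point spheres. -/

namespace FloppyGraph

variable {α β : Type*}

/-- Transport of a floppy graph along a map that is injective on its vertices. -/
theorem exists_map [Nonempty α] (S : FloppyGraph α) (φ : α → β) (hφ : Set.InjOn φ S.V) :
    ∃ T : FloppyGraph β, T.V = φ '' S.V ∧
      (∀ u ∈ S.V, ∀ v ∈ S.V, (T.E (φ u) (φ v) ↔ S.E u v) ∧ T.ρ (φ u) (φ v) = S.ρ u v) := by
  set ψ := Function.invFunOn φ S.V with hψ
  have hl : ∀ u ∈ S.V, ψ (φ u) = u := fun u hu => hφ.leftInvOn_invFunOn hu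
  refine ⟨{ V := φ '' S.V
            E := fun p q => p ∈ φ '' S.V ∧ q ∈ φ '' S.V ∧ S.E (ψ p) (ψ q)
            ρ := fun p q => S.ρ (ψ p) (ψ q)
            mem_left := fun h => h.1
            E_refl := ?_
            E_symm := fun h => ⟨h.2.1, h.1, S.E_symm h.2.2⟩
            ρ_symm := ?_
            ρ_self := ?_
            ρ_pos := ?_
            ρ_tri := ?_
            floppy := ?_ }, rfl, ?_⟩
  · rintro _ ⟨u, hu, rfl⟩
    exact ⟨⟨u, hu, rfl⟩, ⟨u, hu, rfl⟩, by rw [hl u hu]; exact S.E_refl hu⟩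
  · rintro _ _ ⟨u, hu, rfl⟩ ⟨v, hv, rfl⟩
    rw [hl u hu, hl v hv]; exact S.ρ_symm hu hv
  · rintro _ ⟨u, hu, rfl⟩
    rw [hl u hu]; exact S.ρ_self hu
  · rintro _ _ ⟨u, hu, rfl⟩ ⟨v, hv, rfl⟩ h
    rw [hl u hu, hl v hv]; exact S.ρ_pos hu hv (fun e => h (by rw [e]))
  · rintro _ _ _ ⟨u, hu, rfl⟩ ⟨v, hv, rfl⟩ ⟨w, hw, rfl⟩
    rw [hl u hu, hl v hv, hl w hw]; exact S.ρ_tri hu hv hw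
  · rintro _ _ ⟨u, hu, rfl⟩ ⟨v, hv, rfl⟩ h
    have hE : ¬ S.E u v := fun e => h ⟨⟨u, hu, rfl⟩, ⟨v, hv, rfl⟩, by rwa [hl u hu, hl v hv]⟩
    obtain ⟨c, hc, hb⟩ := S.floppy hu hv hE
    rw [hl u hu, hl v hv]
    exact ⟨c, hc, fun p q hpq => hb _ _ hpq.2.2⟩
  · intro u hu v hv
    simp only [hl u hu, hl v hv]
    exact ⟨⟨fun h => h.2.2, fun h => ⟨⟨u, hu, rfl⟩, ⟨v, hv, rfl⟩, h⟩⟩, trivial⟩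

/-- The edges of `S` have lengths in `M`; every sphere of the frozen graph consists of at most two
points, and if a point has an edge of some length, then it has complete spheres of all
commensurable radii in `M`. -/
structure Adapted (M : Set ℝ) (S : FloppyGraph α) : Prop where
  length_mem : ∀ {u v}, S.E u v → S.ρ u v ∈ M
  exists_sphere : ∀ {c z}, S.E c z → z ≠ c → ∀ s ∈ M, s ≠ 0 → s ∈ ratMul {S.ρ c z} →
    ∃ x y, S.E c x ∧ S.E c y ∧ S.E x y ∧ S.ρ c x = s ∧ S.ρ c y = s ∧ S.ρ x y = 2 * s
  sphere_le_two : ∀ {c u v w s}, S.E c u → S.E c v → S.E c w → S.ρ c u = s → S.ρ c v = s →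
    S.ρ c w = s → u = v ∨ u = w ∨ v = w

/-- At a common vertex the two graphs have incommensurable nonzero frozen distances, so each sphere
of positive radius lies entirely in one of them. -/
theorem Adapted.of_union {M : Set ℝ} {S T U : FloppyGraph α} (hS : Adapted M S)
    (hT : Adapted M T) (hE : ∀ u v, U.E u v ↔ S.E u v ∨ T.E u v)
    (h1 : ∀ u v, S.E u v → U.ρ u v = S.ρ u v) (h2 : ∀ u v, T.E u v → U.ρ u v = T.ρ u v)
    (hne : ∀ c p q, S.E c p → T.E c q → p ≠ c → q ≠ c → T.ρ c q ∉ ratMul {S.ρ c p}) :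
    Adapted M U where
  length_mem := by
    intro u v h
    rcases (hE u v).1 h with h | h
    · rw [h1 _ _ h]; exact hS.length_mem h
    · rw [h2 _ _ h]; exact hT.length_mem h
  exists_sphere := by
    intro c z h hzc s hs h0 hr
    rcases (hE c z).1 h with h | h
    · rw [h1 _ _ h] at hr
      obtain ⟨x, y, a, b, c, d, e, f⟩ := hS.exists_sphere h hzc s hs h0 hr
      exact ⟨x, y, (hE _ _).2 (.inl a), (hE _ _).2 (.inl b), (hE _ _).2 (.inl c),
        by rwa [h1 _ _ a], by rwa [h1 _ _ b], by rwa [h1 _ _ c]⟩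
    · rw [h2 _ _ h] at hr
      obtain ⟨x, y, a, b, c, d, e, f⟩ := hT.exists_sphere h hzc s hs h0 hr
      exact ⟨x, y, (hE _ _).2 (.inr a), (hE _ _).2 (.inr b), (hE _ _).2 (.inr c),
        by rwa [h2 _ _ a], by rwa [h2 _ _ b], by rwa [h2 _ _ c]⟩
  sphere_le_two := by
    intro c u v w s hu hv hw eu ev ew
    -- Radius `0` is separate because `0` is commensurable with everything.
    by_cases h0 : s = 0
    · have key : ∀ p, U.E c p → U.ρ c p = s → p = c := by
        intro p hp e
        by_contra hne
        have := U.ρ_pos (U.mem_left hp) (U.mem_right hp) (Ne.symm hne)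
        linarith
      exact Or.inl ((key u hu eu).trans (key v hv ev).symm)
    have nec : ∀ p, U.E c p → U.ρ c p = s → p ≠ c := by
      rintro p hp e rfl
      exact h0 (by rw [← e, U.ρ_self (U.mem_left hp)])
    have mix : ∀ p q, U.E c p → U.E c q → U.ρ c p = s → U.ρ c q = s → S.E c p →
        T.E c q → False := by
      intro p q hp hq ep eq hp' hq'
      refine hne c p q hp' hq' (nec p hp ep) (nec q hq eq) ?_
      rw [← h1 _ _ hp', ← h2 _ _ hq', ep, eq]
      exact mem_ratMul_self s
    rcases (hE _ _).1 hu with hu' | hu'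
    · rcases (hE _ _).1 hv with hv' | hv'
      · rcases (hE _ _).1 hw with hw' | hw'
        · exact hS.sphere_le_two hu' hv' hw' (by rw [← h1 _ _ hu', eu])
            (by rw [← h1 _ _ hv', ev]) (by rw [← h1 _ _ hw', ew])
        · exact (mix _ _ hu hw eu ew hu' hw').elim
      · exact (mix _ _ hu hv eu ev hu' hv').elim
    · rcases (hE _ _).1 hv with hv' | hv'
      · exact (mix _ _ hv hu ev eu hv' hu').elim
      · rcases (hE _ _).1 hw with hw' | hw'
        · exact (mix _ _ hw hu ew eu hw' hu').elim
        · exact hT.sphere_le_two hu' hv' hw' (by rw [← h2 _ _ hu', eu])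
            (by rw [← h2 _ _ hv', ev]) (by rw [← h2 _ _ hw', ew])

theorem Adapted.map {M : Set ℝ} {S : FloppyGraph α} {T : FloppyGraph β} (hS : Adapted M S)
    {φ : α → β} (hV : T.V = φ '' S.V)
    (h : ∀ u ∈ S.V, ∀ v ∈ S.V, (T.E (φ u) (φ v) ↔ S.E u v) ∧ T.ρ (φ u) (φ v) = S.ρ u v) :
    Adapted M T := by
  have hE : ∀ {p q}, T.E p q → ∃ u v, φ u = p ∧ φ v = q ∧ S.E u v ∧ T.ρ p q = S.ρ u v := by
    intro p q hpq
    obtain ⟨u, hu, rfl⟩ := hV ▸ T.mem_left hpq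
    obtain ⟨v, hv, rfl⟩ := hV ▸ T.mem_right hpq
    exact ⟨u, v, rfl, rfl, (h u hu v hv).1.1 hpq, (h u hu v hv).2⟩
  have hE' : ∀ {u v}, S.E u v → T.E (φ u) (φ v) ∧ T.ρ (φ u) (φ v) = S.ρ u v := fun {u v} huv =>
    ⟨(h u (S.mem_left huv) v (S.mem_right huv)).1.2 huv,
      (h u (S.mem_left huv) v (S.mem_right huv)).2⟩
  refine ⟨?_, ?_, ?_⟩
  · intro p q hpq
    obtain ⟨u, v, rfl, rfl, huv, e⟩ := hE hpq
    rw [e]; exact hS.length_mem huv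
  · intro p q hpq hne s hs h0 hr
    obtain ⟨u, v, rfl, rfl, huv, e⟩ := hE hpq
    rw [e] at hr
    obtain ⟨x, y, a, b, c, d, e, f⟩ :=
      hS.exists_sphere huv (fun e => hne (by rw [e])) s hs h0 hr
    exact ⟨φ x, φ y, (hE' a).1, (hE' b).1, (hE' c).1, by rw [(hE' a).2, d],
      by rw [(hE' b).2, e], by rw [(hE' c).2, f]⟩
  · intro c u v w s hu hv hw eu ev ew
    obtain ⟨c, hc, rfl⟩ := hV ▸ T.mem_left hu
    obtain ⟨u, hu', rfl⟩ := hV ▸ T.mem_right hu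
    obtain ⟨v, hv', rfl⟩ := hV ▸ T.mem_right hv
    obtain ⟨w, hw', rfl⟩ := hV ▸ T.mem_right hw
    have a := h c hc u hu'
    have b := h c hc v hv'
    have c := h c hc w hw'
    rcases hS.sphere_le_two (a.1.1 hu) (b.1.1 hv) (c.1.1 hw) (a.2 ▸ eu) (b.2 ▸ ev)
      (c.2 ▸ ew) with rfl | rfl | rfl <;> simp

end FloppyGraph

/-! ### The line of a floppy monoid. -/

/-- The set of the sums `a + b` with `a, b ∈ B` and `b - a = z`. -/
def sumsOfDiff (B : Set ℝ) (z : ℝ) : Set ℝ :=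
  {s | ∃ a ∈ B, ∃ b ∈ B, z = b - a ∧ s = a + b}

/-- The line of a floppy monoid of real numbers. -/
theorem exists_line {B : Set ℝ} (h0 : B ⊆ Set.Ici 0) (hB : IsMonoidSet B) (hF : IsFloppySet B) :
    ∃ S : FloppyGraph ℝ, S.V = {g | ∃ a ∈ B, ∃ b ∈ B, g = b - a} ∧
      (∀ g ∈ S.V, ∀ h ∈ S.V, S.E g h ↔ |g - h| ∈ B) ∧
      (∀ g h, S.E g h → S.ρ g h = |g - h|) := by
  have hz := hB.1
  have hadd : ∀ {a b}, a ∈ B → b ∈ B → a + b ∈ B := fun ha hb => hB.2 ▸ Set.add_mem_add ha hb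
  set G : Set ℝ := {g | ∃ a ∈ B, ∃ b ∈ B, g = b - a} with hG
  have hsub : ∀ {g h}, g ∈ G → h ∈ G → g - h ∈ G := by
    rintro _ _ ⟨a, ha, b, hb, rfl⟩ ⟨c, hc, d, hd, rfl⟩
    exact ⟨a + d, hadd ha hd, b + c, hadd hb hc, by ring⟩
  have lb : ∀ z, ∀ s ∈ sumsOfDiff B z, |z| ≤ s := by
    rintro z s ⟨a, ha, b, hb, rfl, rfl⟩
    have := h0 ha
    have := h0 hb
    simp only [Set.mem_Ici] at *
    rw [abs_le]; constructor <;> linarith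
  have bdd : ∀ z, BddBelow (sumsOfDiff B z) := fun z => ⟨|z|, fun s hs => lb z s hs⟩
  have nonempty : ∀ {z}, z ∈ G → (sumsOfDiff B z).Nonempty := by
    rintro z ⟨a, ha, b, hb, e⟩
    exact ⟨a + b, a, ha, b, hb, e, rfl⟩
  have neg : ∀ z, sumsOfDiff B (-z) = sumsOfDiff B z := by
    have : ∀ z, sumsOfDiff B (-z) ⊆ sumsOfDiff B z := by
      rintro z s ⟨a, ha, b, hb, e, rfl⟩
      exact ⟨b, hb, a, ha, by linarith, by ring⟩
    exact fun z => (this z).antisymm (by simpa using this (-z))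
  have habs : ∀ z, sumsOfDiff B |z| = sumsOfDiff B z := by
    intro z
    rcases abs_choice z with h | h <;> rw [h]
    exact neg z
  have hlow : ∀ {z}, z ∈ G → |z| ≤ sInf (sumsOfDiff B z) := fun hz =>
    le_csInf (nonempty hz) (lb _)
  have heq : ∀ {z}, |z| ∈ B → sInf (sumsOfDiff B z) = |z| := by
    intro z hz'
    have hmem : |z| ∈ sumsOfDiff B z := by
      rw [← habs]; exact ⟨0, hz, |z|, hz', by simp, by simp⟩
    have : z ∈ G := by
      obtain ⟨a, ha, b, hb, e, -⟩ := hmem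
      exact ⟨a, ha, b, hb, e⟩
    exact le_antisymm (csInf_le (bdd z) hmem) (hlow this)
  -- Floppiness of `B` enters here: equality would exhibit `|z|` as the infimum in its definition.
  have hlt : ∀ {z}, z ∈ G → |z| ∉ B → |z| < sInf (sumsOfDiff B z) := by
    intro z hz' hn
    refine lt_of_le_of_ne (hlow hz') fun e => hn (hF _ ?_)
    have := isGLB_csInf (nonempty hz') (bdd z)
    rw [← e, ← habs] at this
    exact this
  refine ⟨{ V := G
            E := fun g h => g ∈ G ∧ h ∈ G ∧ |g - h| ∈ B
            ρ := fun g h => sInf (sumsOfDiff B (g - h))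
            mem_left := fun h => h.1
            E_refl := fun hu => ⟨hu, hu, by simpa using hz⟩
            E_symm := fun h => ⟨h.2.1, h.1, by rw [abs_sub_comm]; exact h.2.2⟩
            ρ_symm := ?_
            ρ_self := ?_
            ρ_pos := ?_
            ρ_tri := ?_
            floppy := ?_ }, rfl, fun g hg h hh => ⟨fun e => e.2.2, fun e => ⟨hg, hh, e⟩⟩,
            fun g h e => heq e.2.2⟩
  · intro u v _ _
    rw [← neg, neg_sub]
  · intro u _
    rw [heq] <;> simp [hz]
  · intro u v hu hv huv
    exact lt_of_lt_of_le (abs_pos.2 (sub_ne_zero.2 huv)) (hlow (hsub hu hv))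
  · intro u v w hu hv hw
    refine le_of_forall_pos_lt_add fun ε hε => ?_
    obtain ⟨s, hs, hs'⟩ := exists_lt_of_csInf_lt (nonempty (hsub hu hv))
      (lt_add_of_pos_right (sInf (sumsOfDiff B (u - v))) (half_pos hε))
    obtain ⟨t, ht, ht'⟩ := exists_lt_of_csInf_lt (nonempty (hsub hv hw))
      (lt_add_of_pos_right (sInf (sumsOfDiff B (v - w))) (half_pos hε))
    have : s + t ∈ sumsOfDiff B (u - w) := by
      obtain ⟨a, ha, b, hb, e, rfl⟩ := hs
      obtain ⟨c, hc, d, hd, f, rfl⟩ := ht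
      exact ⟨a + c, hadd ha hc, b + d, hadd hb hd, by linarith, by ring⟩
    have := csInf_le (bdd _) this
    linarith
  -- The metric dominates the Euclidean one and equals it on edges, so edges force no more than `|u
  -- - v|`.
  · intro u v hu hv huv
    have hn : |u - v| ∉ B := fun h => huv ⟨hu, hv, h⟩
    refine ⟨|u - v|, hlt (hsub hu hv) hn, fun p q hpq => ?_⟩
    rw [heq hpq.2.2]
    have h1 := hlow (hsub hpq.1 hu)
    have h2 := hlow (hsub hpq.2.1 hv)
    have h3 : |p - q| ≤ |p - u| + |u - v| + |q - v| := by
      have e1 := abs_sub_le p u q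
      have e2 := abs_sub_le u v q
      rw [abs_sub_comm v q] at e2
      linarith
    linarith

/-- The sphere of radius `s` about `c` is `{c + s, c - s}`, and these two points are frozen since
the monoid contains `s + s`. -/
theorem exists_adapted_line {M : Set ℝ} {r : ℝ} (h0 : M ⊆ Set.Ici 0)
    (hB : IsMonoidSet (M ∩ ratMul {r})) (hF : IsFloppySet (M ∩ ratMul {r})) (hr : r ∈ M) :
    ∃ S : FloppyGraph ℝ, S.V ⊆ ratMul {r} ∧ 0 ∈ S.V ∧ r ∈ S.V ∧ S.E 0 r ∧ S.ρ 0 r = r ∧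
      (∀ u v, S.E u v → S.ρ u v ∈ ratMul {r}) ∧ S.Adapted M := by
  obtain ⟨S, hV, hE, hρ⟩ := exists_line (Set.inter_subset_left.trans h0) hB hF
  have hadd : ∀ {a b}, a ∈ M ∩ ratMul {r} → b ∈ M ∩ ratMul {r} → a + b ∈ M ∩ ratMul {r} :=
    fun ha hb => hB.2 ▸ Set.add_mem_add ha hb
  have hrB : r ∈ M ∩ ratMul {r} := ⟨hr, mem_ratMul_self r⟩
  have hr' : 0 ≤ r := h0 hr
  have h0V : (0 : ℝ) ∈ S.V := hV ▸ ⟨0, hB.1, 0, hB.1, by simp⟩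
  have hrV : r ∈ S.V := hV ▸ ⟨0, hB.1, r, hrB, by simp⟩
  have hE0 : S.E 0 r := (hE _ h0V _ hrV).2 (by rwa [zero_sub, abs_neg, abs_of_nonneg hr'])
  have hB' : ∀ {u v}, S.E u v → |u - v| ∈ M ∩ ratMul {r} := fun h =>
    (hE _ (S.mem_left h) _ (S.mem_right h)).1 h
  have hsubV : ∀ {g b}, g ∈ S.V → b ∈ M ∩ ratMul {r} → g + b ∈ S.V ∧ g - b ∈ S.V := by
    intro g b hg hb
    rw [hV] at hg ⊢
    obtain ⟨a, ha, d, hd, rfl⟩ := hg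
    exact ⟨⟨a, ha, d + b, hadd hd hb, by ring⟩, ⟨a + b, hadd ha hb, d, hd, by ring⟩⟩
  refine ⟨S, ?_, h0V, hrV, hE0, ?_, ?_, ?_, ?_, ?_⟩
  · rw [hV]
    rintro _ ⟨a, ⟨-, ha⟩, b, ⟨-, hb⟩, rfl⟩
    obtain ⟨q, rfl⟩ := mem_ratMul_singleton.1 ha
    obtain ⟨q', rfl⟩ := mem_ratMul_singleton.1 hb
    exact mem_ratMul_singleton.2 ⟨q' - q, by push_cast; ring⟩
  · rw [hρ _ _ hE0, zero_sub, abs_neg, abs_of_nonneg hr']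
  · intro u v h
    rw [hρ _ _ h]; exact (hB' h).2
  · intro u v h
    rw [hρ _ _ h]; exact (hB' h).1
  · intro c z h hne s hs hs0 hsr
    rw [hρ _ _ h] at hsr
    have hs' : s ∈ M ∩ ratMul {r} := ⟨hs, ratMul_trans hsr (hB' h).2⟩
    have hc := S.mem_left h
    obtain ⟨h1, h2⟩ := hsubV hc hs'
    have sn : 0 ≤ s := h0 hs
    have a1 : |c - (c + s)| = s := by rw [abs_sub_comm]; simp [abs_of_nonneg sn]
    have a2 : |c - (c - s)| = s := by simp [abs_of_nonneg sn]
    have a3 : |c + s - (c - s)| = 2 * s := by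
      rw [show c + s - (c - s) = 2 * s by ring, abs_of_nonneg (by linarith)]
    have e1 := (hE _ hc _ h1).2 (by rwa [a1])
    have e2 := (hE _ hc _ h2).2 (by rwa [a2])
    have e3 := (hE _ h1 _ h2).2 (by rw [a3, two_mul]; exact hadd hs' hs')
    exact ⟨c + s, c - s, e1, e2, e3, by rw [hρ _ _ e1, a1], by rw [hρ _ _ e2, a2],
      by rw [hρ _ _ e3, a3]⟩
  · intro c u v w s hu hv hw eu ev ew
    rw [hρ _ _ hu] at eu
    rw [hρ _ _ hv] at ev
    rw [hρ _ _ hw] at ew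
    have key : ∀ t, |c - t| = s → t = c + s ∨ t = c - s := by
      intro t ht
      rcases abs_choice (c - t) with h | h <;> rw [h] at ht
      · right; linarith
      · left; linarith
    rcases key u eu with rfl | rfl <;> rcases key v ev with rfl | rfl <;>
      rcases key w ew with rfl | rfl <;> simp

/-! ### Attaching lines. -/

namespace FloppyGraph

variable {α : Type*}

/-- `S ≤ T` if `T` has more vertices and more frozen pairs, with the same frozen distances. -/
instance : Preorder (FloppyGraph α) where
  le S T := S.V ⊆ T.V ∧ ∀ u v, S.E u v → T.E u v ∧ T.ρ u v = S.ρ u v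
  le_refl S := ⟨subset_rfl, fun _ _ h => ⟨h, rfl⟩⟩
  le_trans S T U h h' := ⟨h.1.trans h'.1, fun u v huv =>
    have a := h.2 u v huv
    have b := h'.2 u v a.1
    ⟨b.1, b.2.trans a.2⟩⟩

theorem exists_injOn_of_infinite {s : Set ℝ} (hs : s.Countable) {N : Set α} (hN : N.Infinite) :
    ∃ j : ℝ → α, Set.InjOn j s ∧ ∀ g, j g ∈ N := by
  obtain ⟨f, hf⟩ := Set.countable_iff_exists_injOn.1 hs
  refine ⟨fun g => hN.natEmbedding N (f g), fun a ha b hb h => hf ha hb ?_,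
    fun g => (hN.natEmbedding N (f g)).2⟩
  exact (hN.natEmbedding N).injective (Subtype.ext h)

/-- Attaching a line of step `r` to a frozen pair `{x, y}` of length `r`, or to a point `x = y`. -/
theorem Adapted.exists_attach {M : Set ℝ} {S S' : FloppyGraph α} (hS : S.Adapted M) {x y : α}
    (hx : x ∈ S.V) (hy : y ∈ S.V) (hV : S'.V = S.V)
    (hE : ∀ u v, S'.E u v ↔ S.E u v ∨ (u = x ∧ v = y) ∨ (u = y ∧ v = x))
    (hρ : ∀ u v, S.E u v → S'.ρ u v = S.ρ u v)
    {r : ℝ} (hr : x ≠ y → S'.ρ x y = r)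
    (hst : ∀ u ∈ S.V, u ≠ x → u ≠ y → S'.ρ x y < S'.ρ u x + S'.ρ u y ∧
      (x ≠ y → S.E u y → S'.ρ u y < S'.ρ u x + S'.ρ x y) ∧
      (x ≠ y → S.E u x → S'.ρ u x < S'.ρ u y + S'.ρ x y))
    (hnew : ∀ c z, c = x ∨ c = y → S.E c z → z ≠ c → r ∉ ratMul {S.ρ c z})
    {N : Set α} (hN : N.Infinite) (hNV : Disjoint N S.V) (hM : M ⊆ Set.Ici 0)
    (hB : IsMonoidSet (M ∩ ratMul {r})) (hF : IsFloppySet (M ∩ ratMul {r})) (hrM : r ∈ M)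
    (hr0 : r ≠ 0) :
    ∃ U, S ≤ U ∧ U.Adapted M ∧ U.V ⊆ S.V ∪ N ∧ U.E x y ∧
      (∃ z, U.E x z ∧ z ≠ x ∧ r ∈ ratMul {U.ρ x z}) ∧
      ∀ u v, U.E u v → S.E u v ∨ U.ρ u v ∈ ratMul {r} := by
  classical
  obtain ⟨L, hLV, h0, hrL, hLE, hLρ, hLr, hL⟩ := exists_adapted_line hM hB hF hrM
  obtain ⟨j, hj, hjN⟩ := exists_injOn_of_infinite ((countable_ratMul_singleton r).mono hLV) hN
  have hjS : ∀ g, j g ∉ S.V := fun g => Set.disjoint_left.1 hNV (hjN g)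
  -- The line is placed with `0` at `x`, with `r` at `y` if `x ≠ y`, and with all other points
  -- fresh. If `x = y`, the point `r` is fresh too.
  set φ : ℝ → α := fun g => if g = 0 then x else if g = r ∧ x ≠ y then y else j g with hφ
  have φ0 : φ 0 = x := by simp [hφ]
  have φr : x ≠ y → φ r = y := fun h => by simp [hφ, hr0, h]
  have φj : ∀ g, g ≠ 0 → ¬ (g = r ∧ x ≠ y) → φ g = j g := fun g h h' => by
    simp only [hφ, h, h', if_false]
  have hφi : Set.InjOn φ L.V := by
    intro a ha b hb h
    by_cases a0 : a = 0 <;> by_cases b0 : b = 0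
    · rw [a0, b0]
    · rw [a0, φ0] at h
      by_cases hb' : b = r ∧ x ≠ y
      · rw [hb'.1, φr hb'.2] at h; exact absurd h hb'.2
      · rw [φj b b0 hb'] at h; exact absurd (h ▸ hx) (hjS b)
    · rw [b0, φ0] at h
      by_cases ha' : a = r ∧ x ≠ y
      · rw [ha'.1, φr ha'.2] at h; exact absurd h.symm ha'.2
      · rw [φj a a0 ha'] at h; exact absurd (h ▸ hx) (hjS a)
    · by_cases ha' : a = r ∧ x ≠ y <;> by_cases hb' : b = r ∧ x ≠ y
      · rw [ha'.1, hb'.1]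
      · rw [ha'.1, φr ha'.2, φj b b0 hb'] at h; exact absurd (h ▸ hy) (hjS b)
      · rw [hb'.1, φr hb'.2, φj a a0 ha'] at h; exact absurd (h ▸ hy) (hjS a)
      · rw [φj a a0 ha', φj b b0 hb'] at h; exact hj ha hb h
  obtain ⟨T, hTV, hT⟩ := exists_map L φ hφi
  have hTA : T.Adapted M := hL.map hTV hT
  have hTr : ∀ p q, T.E p q → T.ρ p q ∈ ratMul {r} := by
    intro p q hpq
    obtain ⟨u, hu, rfl⟩ := hTV ▸ T.mem_left hpq
    obtain ⟨v, hv, rfl⟩ := hTV ▸ T.mem_right hpq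
    rw [(hT u hu v hv).2]
    exact hLr _ _ ((hT u hu v hv).1.1 hpq)
  have hxT : x ∈ T.V := hTV ▸ ⟨0, h0, φ0⟩
  have hyT : y ∈ T.V := by
    by_cases h : x = y
    · exact h ▸ hxT
    · exact hTV ▸ ⟨r, hrL, φr h⟩
  have hxyT : T.E x y := by
    by_cases h : x = y
    · rw [← h]; exact T.E_refl hxT
    · have := (hT 0 h0 r hrL).1.2 hLE
      rwa [φ0, φr h] at this
  have hxyρ : S'.ρ x y = T.ρ x y := by
    by_cases h : x = y
    · rw [← h, T.ρ_self hxT, S'.ρ_self (hV ▸ hx)]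
    · have := (hT 0 h0 r hrL).2
      rw [φ0, φr h, hLρ] at this
      rw [this, hr h]
  have hint : S.V ∩ T.V = {x, y} := by
    ext p
    simp only [Set.mem_inter_iff, Set.mem_insert_iff, Set.mem_singleton_iff]
    constructor
    · rintro ⟨hp, hp'⟩
      obtain ⟨g, hg, rfl⟩ := hTV ▸ hp'
      by_cases g0 : g = 0
      · left; rw [g0, φ0]
      · by_cases g1 : g = r ∧ x ≠ y
        · right; rw [g1.1, φr g1.2]
        · rw [φj g g0 g1] at hp; exact absurd hp (hjS g)
    · rintro (rfl | rfl)
      exacts [⟨hx, hxT⟩, ⟨hy, hyT⟩]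
  obtain ⟨U, hUV, hUE, hU1, hU2⟩ := glue S' T (x := x) (y := y) (by rw [hV, hint])
    ((hE x y).2 (Or.inr (Or.inl ⟨rfl, rfl⟩))) hxyT hxyρ (by
      intro u hu hux huy
      obtain ⟨a, b, c⟩ := hst u (hV ▸ hu) hux huy
      refine ⟨a, fun h h' => b h ?_, fun h h' => c h ?_⟩
      · rcases (hE _ _).1 h' with h' | h' | h'
        exacts [h', absurd h'.1 hux, absurd h'.1 huy]
      · rcases (hE _ _).1 h' with h' | h' | h'
        exacts [h', absurd h'.1 hux, absurd h'.1 huy])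
  have hSS' : ∀ u v, S.E u v → S'.E u v := fun u v h => (hE u v).2 (Or.inl h)
  have hUE' : ∀ u v, U.E u v ↔ S.E u v ∨ T.E u v := by
    intro u v
    rw [hUE, hE]
    constructor
    · rintro ((h | ⟨rfl, rfl⟩ | ⟨rfl, rfl⟩) | h)
      exacts [Or.inl h, Or.inr hxyT, Or.inr (T.E_symm hxyT), Or.inr h]
    · rintro (h | h)
      exacts [Or.inl (Or.inl h), Or.inr h]
  have hU1' : ∀ u v, S.E u v → U.ρ u v = S.ρ u v := fun u v h =>
    (hU1 u v (hSS' u v h)).trans (hρ u v h)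
  refine ⟨U, ⟨?_, fun u v h => ⟨(hUE' u v).2 (Or.inl h), hU1' u v h⟩⟩,
    hS.of_union hTA hUE' hU1' hU2 ?_, ?_, (hUE' _ _).2 (Or.inr hxyT), ?_, ?_⟩
  · rw [hUV, hV]; exact Set.subset_union_left
  · intro c p q hp hq hpc hqc hmem
    have hc : c ∈ S.V ∩ T.V := ⟨S.mem_left hp, T.mem_left hq⟩
    rw [hint] at hc
    refine hnew c p hc hp hpc (ratMul_trans (ratMul_symm (hTr _ _ hq) ?_) hmem)
    exact (T.ρ_pos (T.mem_left hq) (T.mem_right hq) hqc.symm).ne'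
  · rw [hUV, hV, hTV]
    rintro p (hp | ⟨g, hg, rfl⟩)
    · exact Or.inl hp
    · by_cases g0 : g = 0
      · left; rwa [g0, φ0]
      · by_cases g1 : g = r ∧ x ≠ y
        · left; rwa [g1.1, φr g1.2]
        · right; rw [φj g g0 g1]; exact hjN g
  · have hE := (hT 0 h0 r hrL).1.2 hLE
    have hρ := (hT 0 h0 r hrL).2
    rw [φ0] at hE hρ
    refine ⟨φ r, (hUE' _ _).2 (Or.inr hE), fun h => hr0 (hφi hrL h0 (by rw [h, φ0])), ?_⟩
    rw [hU2 _ _ hE, hρ, hLρ]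
    exact mem_ratMul_self r
  · intro u v h
    rcases (hUE' u v).1 h with h | h
    · exact Or.inl h
    · right; rw [hU2 _ _ h]; exact hTr _ _ h

/-- An adapted graph that leaves room in `W` for further points, and that has used less than `|M|`
many classes of commensurable distances. -/
structure Roomy (M : Set ℝ) (W : Set α) (S : FloppyGraph α) : Prop where
  adapted : S.Adapted M
  subset : S.V ⊆ W
  infinite : (W \ S.V).Infinite
  few : ∃ B ⊆ M, Cardinal.mk B < Cardinal.mk M ∧ ∀ u v, S.E u v → S.ρ u v ∈ ratMul B

/-- The unused points of `W` are split into two infinite halves: one hosts the line, the other stays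
free. Only the class of `r` is added to those already used. -/
theorem Roomy.exists_attach {M : Set ℝ} {W : Set α} {S S' : FloppyGraph α} (hS : S.Roomy M W)
    {x y : α}
    (hx : x ∈ S.V) (hy : y ∈ S.V) (hV : S'.V = S.V)
    (hE : ∀ u v, S'.E u v ↔ S.E u v ∨ (u = x ∧ v = y) ∨ (u = y ∧ v = x))
    (hρ : ∀ u v, S.E u v → S'.ρ u v = S.ρ u v)
    {r : ℝ} (hr : x ≠ y → S'.ρ x y = r)
    (hst : ∀ u ∈ S.V, u ≠ x → u ≠ y → S'.ρ x y < S'.ρ u x + S'.ρ u y ∧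
      (x ≠ y → S.E u y → S'.ρ u y < S'.ρ u x + S'.ρ x y) ∧
      (x ≠ y → S.E u x → S'.ρ u x < S'.ρ u y + S'.ρ x y))
    (hnew : ∀ c z, c = x ∨ c = y → S.E c z → z ≠ c → r ∉ ratMul {S.ρ c z})
    (hM : M ⊆ Set.Ici 0) (hinf : M.Infinite)
    (hmon : ∀ r ∈ M, IsMonoidSet (M ∩ ratMul {r}) ∧ IsFloppySet (M ∩ ratMul {r})) (hrM : r ∈ M)
    (hr0 : r ≠ 0) :
    ∃ U, S ≤ U ∧ U.Roomy M W ∧ U.E x y ∧ ∃ z, U.E x z ∧ z ≠ x ∧ r ∈ ratMul {U.ρ x z} := by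
  obtain ⟨N, N', hNN, hd, hc⟩ := hS.infinite.exists_union_disjoint_cardinal_eq_of_infinite
  have hNinf : N.Infinite ∧ N'.Infinite := by
    have h1 : N.Infinite ∨ N'.Infinite := by
      rw [← Set.infinite_union, hNN]; exact hS.infinite
    have h2 : N.Infinite ↔ N'.Infinite := by
      rw [← Set.infinite_coe_iff, ← Set.infinite_coe_iff, Cardinal.infinite_iff,
        Cardinal.infinite_iff, hc]
    tauto
  have hNs : N ⊆ W \ S.V := hNN ▸ Set.subset_union_left
  have hNs' : N' ⊆ W \ S.V := hNN ▸ Set.subset_union_right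
  obtain ⟨U, h1, h2, h3, h4, h5, h6⟩ := hS.adapted.exists_attach hx hy hV hE hρ hr hst hnew
    hNinf.1 (Set.disjoint_left.2 fun p hp => (hNs hp).2) hM (hmon r hrM).1 (hmon r hrM).2 hrM hr0
  obtain ⟨B, hBM, hBc, hB⟩ := hS.few
  refine ⟨U, h1, ⟨h2, ?_, ?_, insert r B, Set.insert_subset hrM hBM, ?_, ?_⟩, h4, h5⟩
  · exact h3.trans (Set.union_subset hS.subset fun p hp => (hNs hp).1)
  · refine hNinf.2.mono fun p hp => ⟨(hNs' hp).1, fun hpU => ?_⟩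
    rcases h3 hpU with h | h
    · exact (hNs' hp).2 h
    · exact Set.disjoint_left.1 hd h hp
  · have hM' : Cardinal.aleph0 ≤ Cardinal.mk M := by
      have := hinf.to_subtype
      exact Cardinal.aleph0_le_mk M
    exact Cardinal.mk_insert_le.trans_lt (Cardinal.add_lt_of_lt hM' hBc
      (Cardinal.one_lt_aleph0.trans_le hM'))
  · intro u v huv
    rcases h6 u v huv with h | h
    · rw [(h1.2 u v h).2]
      exact ratMul_mono (Set.subset_insert r B) (hB u v h)
    · exact ratMul_mono (by simp) h

theorem Roomy.exists_adj {M : Set ℝ} {W : Set α} {S : FloppyGraph α} (hS : S.Roomy M W)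
    (hM : M ⊆ Set.Ici 0) (hinf : M.Infinite)
    (hmon : ∀ r ∈ M, IsMonoidSet (M ∩ ratMul {r}) ∧ IsFloppySet (M ∩ ratMul {r}))
    (hdense : ∀ B ⊆ M, Cardinal.mk B < Cardinal.mk M → ∀ a b : ℝ, 0 ≤ a → a < b →
      ∃ t ∈ M, a < t ∧ t < b ∧ t ∉ ratMul B) {x y : α} (hx : x ∈ S.V) (hy : y ∈ S.V) :
    ∃ U, S ≤ U ∧ U.Roomy M W ∧ U.E x y := by
  by_cases hxy : S.E x y
  · exact ⟨S, le_rfl, hS, hxy⟩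
  have hne : x ≠ y := by rintro rfl; exact hxy (S.E_refl hx)
  obtain ⟨c, hc, hb⟩ := S.floppy hx hy hxy
  obtain ⟨B, hBM, hBc, hB⟩ := hS.few
  -- Above `c`, the new length respects the frozen distances; outside `ratMul B`, it creates no
  -- third point on an old sphere.
  obtain ⟨t, htM, h1, h2, h3⟩ := hdense B hBM hBc (max c 0) (S.ρ x y) (le_max_right _ _)
    (max_lt hc (S.ρ_pos hx hy hne))
  have ht : 0 < t := (le_max_right _ _).trans_lt h1
  obtain ⟨S', hV, hE, hρ, hρt, hst⟩ := S.addEdge hx hy hb ((le_max_left _ _).trans_lt h1) ht h2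
  obtain ⟨U, a, b, c, -⟩ := hS.exists_attach hx hy hV hE hρ (fun _ => hρt)
    (fun u hu hux huy => by
      rw [hρt]
      obtain ⟨p, q, r⟩ := hst u hu hux huy
      exact ⟨p, fun _ => q, fun _ => r⟩)
    (fun c z _ hz _ hmem => h3 (ratMul_trans hmem (hB c z hz))) hM hinf hmon htM ht.ne'
  exact ⟨U, a, b, c⟩

/-- The degenerate case `x = y` of attaching: incommensurability at `x` holds because otherwise the
radius is already served. -/
theorem Roomy.exists_sphere {M : Set ℝ} {W : Set α} {S : FloppyGraph α} (hS : S.Roomy M W)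
    (hM : M ⊆ Set.Ici 0) (hinf : M.Infinite)
    (hmon : ∀ r ∈ M, IsMonoidSet (M ∩ ratMul {r}) ∧ IsFloppySet (M ∩ ratMul {r}))
    {x : α} (hx : x ∈ S.V) {r : ℝ} (hr : r ∈ M) (hr0 : r ≠ 0) :
    ∃ U, S ≤ U ∧ U.Roomy M W ∧ ∃ z, U.E x z ∧ z ≠ x ∧ r ∈ ratMul {U.ρ x z} := by
  by_cases h : ∃ z, S.E x z ∧ z ≠ x ∧ r ∈ ratMul {S.ρ x z}
  · exact ⟨S, le_rfl, hS, h⟩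
  obtain ⟨U, a, b, -, c⟩ := hS.exists_attach (S' := S) (r := r) hx hx rfl (fun u v => by
      simp only [or_self, iff_self_or]
      rintro ⟨rfl, rfl⟩
      exact S.E_refl hx) (fun _ _ _ => rfl) (fun h => absurd rfl h) (fun u hu hux _ => by
      have := S.ρ_pos hu hx hux
      rw [S.ρ_self hx]
      exact ⟨by linarith, fun h => absurd rfl h, fun h => absurd rfl h⟩)
    (fun c z hc hz hzc hmem => h ⟨z, by
      rcases hc with rfl | rfl <;> exact ⟨hz, hzc, hmem⟩⟩) hM hinf hmon hr hr0
  exact ⟨U, a, b, c⟩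

end FloppyGraph

/-! ### Meeting families of cofinal requirements. -/

theorem exists_seq_of_dense {P ι : Type*} [Preorder P] [Countable ι] [Nonempty ι]
    (D : ι → Set P) (hD : ∀ i p, ∃ q, p ≤ q ∧ q ∈ D i) (p₀ : P) :
    ∃ s : ℕ → P, Monotone s ∧ s 0 = p₀ ∧ ∀ i n, ∃ m, n ≤ m ∧ s m ∈ D i := by
  choose next hle hmem using hD
  obtain ⟨g, hg⟩ := exists_surjective_nat ι
  -- Unpairing makes every requirement recur infinitely often, so it is also met for vertices that
  -- appear late.
  let s : ℕ → P := fun n => Nat.rec p₀ (fun n p => next (g n.unpair.1) p) n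
  refine ⟨s, monotone_nat_of_le_succ fun n => hle _ _, rfl, fun i n => ?_⟩
  obtain ⟨k, rfl⟩ := hg i
  refine ⟨Nat.pair k n + 1, (Nat.right_le_pair k n).trans (Nat.le_succ _), ?_⟩
  have : s (Nat.pair k n + 1) = next (g (Nat.pair k n).unpair.1) (s (Nat.pair k n)) := rfl
  rw [this, Nat.unpair_pair]
  exact hmem _ _

theorem exists_monotone_of_dense {P I : Type*} [Preorder P] [LinearOrder I] [WellFoundedLT I]
    (hI : ∀ i : I, (Set.Iio i).Countable)
    (hub : ∀ s : Set P, s.Countable → s.Nonempty → IsChain (· ≤ ·) s → BddAbove s)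
    (D : I → Set P) (hD : ∀ i p, ∃ q, p ≤ q ∧ q ∈ D i) (p₀ : P) :
    ∃ f : I → P, Monotone f ∧ ∀ i, f i ∈ D i := by
  classical
  -- The default `p₀` is never taken: by induction the earlier values form a countable chain, which
  -- is bounded.
  let F : ∀ i : I, (∀ j, j < i → P) → P := fun i g =>
    if h : ∃ p ∈ D i, ∀ j hj, g j hj ≤ p then h.choose else p₀
  let f : I → P := (wellFounded_lt (α := I)).fix F
  have hf : ∀ i, f i = F i fun j _ => f j := fun i => WellFounded.fix_eq _ _ _
  have key : ∀ i, f i ∈ D i ∧ ∀ j < i, f j ≤ f i := by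
    intro i
    induction i using WellFoundedLT.induction with
    | ind i ih =>
      have hex : ∃ p ∈ D i, ∀ j, j < i → f j ≤ p := by
        obtain ⟨b, hb⟩ : ∃ b, ∀ j < i, f j ≤ b := by
          rcases (Set.Iio i).eq_empty_or_nonempty with h | h
          · exact ⟨p₀, fun j hj => absurd (show j ∈ Set.Iio i from hj) (by simp [h])⟩
          · obtain ⟨b, hb⟩ := hub (f '' Set.Iio i) ((hI i).image f) (h.image f) (by
              rintro _ ⟨j, hj, rfl⟩ _ ⟨k, hk, rfl⟩ hne
              rcases lt_trichotomy j k with h | h | h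
              · exact Or.inl ((ih k hk).2 j h)
              · exact absurd (by rw [h]) hne
              · exact Or.inr ((ih j hj).2 k h))
            exact ⟨b, fun j hj => hb ⟨j, hj, rfl⟩⟩
        obtain ⟨q, hq, hqD⟩ := hD i b
        exact ⟨q, hqD, fun j hj => (hb j hj).trans hq⟩
      have : f i = hex.choose := by
        rw [hf i]; exact dif_pos hex
      rw [this]
      exact hex.choose_spec
  refine ⟨f, fun i j hij => ?_, fun i => (key i).1⟩
  rcases hij.eq_or_lt with rfl | h
  · exact le_rfl
  · exact (key j).2 i h

/-! ### Unions of chains and fully frozen graphs. -/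

namespace FloppyGraph

variable {α : Type*}

/-- The point `c` has frozen spheres of all radii commensurable to `r`. -/
def HasRadius (S : FloppyGraph α) (c : α) (r : ℝ) : Prop :=
  ∃ z, S.E c z ∧ z ≠ c ∧ r ∈ ratMul {S.ρ c z}

theorem HasRadius.mono {S T : FloppyGraph α} (h : S ≤ T) {c : α} {r : ℝ}
    (hc : S.HasRadius c r) : T.HasRadius c r := by
  obtain ⟨z, hz, hne, hr⟩ := hc
  exact ⟨z, (h.2 _ _ hz).1, hne, by rwa [(h.2 _ _ hz).2]⟩

/-- All pairs of vertices are frozen. -/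
def Full (S : FloppyGraph α) : Prop :=
  ∀ u ∈ S.V, ∀ v ∈ S.V, S.E u v

/-- Each axiom involves finitely many pairs, all frozen in a single member of the directed family.
Floppiness is vacuous in the limit. -/
theorem exists_full_union {M : Set ℝ} {ι : Type*} (s : ι → FloppyGraph α)
    (hd : Directed (· ≤ ·) s) (hA : ∀ i, (s i).Adapted M)
    (hfull : ∀ i, ∀ u ∈ (s i).V, ∀ v ∈ (s i).V, ∃ k, (s k).E u v) :
    ∃ U : FloppyGraph α, (∀ i, s i ≤ U) ∧ U.V = ⋃ i, (s i).V ∧ U.Adapted M ∧ U.Full := by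
  classical
  set V : Set α := ⋃ i, (s i).V with hV
  have hE : ∀ {u v}, u ∈ V → v ∈ V → ∃ k, (s k).E u v := by
    intro u v hu hv
    obtain ⟨i, hi⟩ := Set.mem_iUnion.1 hu
    obtain ⟨j, hj⟩ := Set.mem_iUnion.1 hv
    obtain ⟨k, hik, hjk⟩ := hd i j
    exact hfull k u (hik.1 hi) v (hjk.1 hj)
  set d : α → α → ℝ := fun u v =>
    if h : ∃ k, (s k).E u v then (s h.choose).ρ u v else 0 with hdef
  have hdk : ∀ {k u v}, (s k).E u v → d u v = (s k).ρ u v := by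
    intro k u v h
    have hex : ∃ k, (s k).E u v := ⟨k, h⟩
    simp only [hdef, dif_pos hex]
    obtain ⟨l, h1, h2⟩ := hd hex.choose k
    rw [← (h1.2 u v hex.choose_spec).2, ← (h2.2 u v h).2]
  have hVk : ∀ {k u}, u ∈ (s k).V → u ∈ V := fun h => Set.mem_iUnion.2 ⟨_, h⟩
  have three : ∀ {a b c e f g : α}, a ∈ V → b ∈ V → c ∈ V → e ∈ V → f ∈ V → g ∈ V →
      ∃ k, (s k).E a b ∧ (s k).E c e ∧ (s k).E f g := by
    intro a b c e f g ha hb hc he hf hg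
    obtain ⟨i, hi⟩ := hE ha hb
    obtain ⟨j, hj⟩ := hE hc he
    obtain ⟨l, hl⟩ := hE hf hg
    obtain ⟨m, h1, h2⟩ := hd i j
    obtain ⟨n, h3, h4⟩ := hd m l
    exact ⟨n, (h3.2 _ _ (h1.2 _ _ hi).1).1, (h3.2 _ _ (h2.2 _ _ hj).1).1, (h4.2 _ _ hl).1⟩
  refine ⟨{ V := V
            E := fun u v => u ∈ V ∧ v ∈ V
            ρ := d
            mem_left := fun h => h.1
            E_refl := fun h => ⟨h, h⟩
            E_symm := fun h => ⟨h.2, h.1⟩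
            ρ_symm := ?_
            ρ_self := ?_
            ρ_pos := ?_
            ρ_tri := ?_
            floppy := fun hu hv h => absurd ⟨hu, hv⟩ h },
    fun i => ⟨fun u hu => hVk hu, fun u v h =>
      ⟨⟨hVk ((s i).mem_left h), hVk ((s i).mem_right h)⟩, hdk h⟩⟩, rfl, ⟨?_, ?_, ?_⟩,
    fun u hu v hv => ⟨hu, hv⟩⟩
  · intro u v hu hv
    obtain ⟨k, hk⟩ := hE hu hv
    rw [hdk hk, hdk ((s k).E_symm hk), (s k).ρ_symm ((s k).mem_left hk) ((s k).mem_right hk)]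
  · intro u hu
    obtain ⟨k, hk⟩ := hE hu hu
    rw [hdk hk, (s k).ρ_self ((s k).mem_left hk)]
  · intro u v hu hv huv
    obtain ⟨k, hk⟩ := hE hu hv
    rw [hdk hk]
    exact (s k).ρ_pos ((s k).mem_left hk) ((s k).mem_right hk) huv
  · intro u v w hu hv hw
    obtain ⟨k, h1, h2, h3⟩ := three hu hv hv hw hu hw
    rw [hdk h1, hdk h2, hdk h3]
    exact (s k).ρ_tri ((s k).mem_left h1) ((s k).mem_left h2) ((s k).mem_right h2)
  · rintro u v ⟨hu, hv⟩
    obtain ⟨k, hk⟩ := hE hu hv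
    change d u v ∈ M
    rw [hdk hk]
    exact (hA k).length_mem hk
  · rintro c z ⟨hc, hz⟩ hzc r hr hr0 hrz
    obtain ⟨k, hk⟩ := hE hc hz
    change r ∈ ratMul {d c z} at hrz
    rw [hdk hk] at hrz
    obtain ⟨x, y, h1, h2, h3, h4, h5, h6⟩ := (hA k).exists_sphere hk hzc r hr hr0 hrz
    have hx := hVk ((s k).mem_right h1)
    have hy := hVk ((s k).mem_right h2)
    exact ⟨x, y, ⟨hc, hx⟩, ⟨hc, hy⟩, ⟨hx, hy⟩, (hdk h1).trans h4, (hdk h2).trans h5,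
      (hdk h3).trans h6⟩
  · rintro c u v w r ⟨hc, hu⟩ ⟨-, hv⟩ ⟨-, hw⟩ eu ev ew
    obtain ⟨k, h1, h2, h3⟩ := three hc hu hc hv hc hw
    exact (hA k).sphere_le_two h1 h2 h3 ((hdk h1).symm.trans eu) ((hdk h2).symm.trans ev)
      ((hdk h3).symm.trans ew)

/-- As `W` and `R` are countable, there are countably many tasks: freeze a pair, or give a point a
radius. Each intermediate graph remains roomy; the union need not. -/
theorem Roomy.exists_full {M : Set ℝ} {W : Set α} {S : FloppyGraph α} (hS : S.Roomy M W)
    (hM : M ⊆ Set.Ici 0) (hinf : M.Infinite)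
    (hmon : ∀ r ∈ M, IsMonoidSet (M ∩ ratMul {r}) ∧ IsFloppySet (M ∩ ratMul {r}))
    (hdense : ∀ B ⊆ M, Cardinal.mk B < Cardinal.mk M → ∀ a b : ℝ, 0 ≤ a → a < b →
      ∃ t ∈ M, a < t ∧ t < b ∧ t ∉ ratMul B) (hW : W.Countable) {R : Set ℝ} (hR : R.Countable)
    (hRM : R ⊆ M) :
    ∃ U, S ≤ U ∧ U.Adapted M ∧ U.V ⊆ W ∧ U.Full ∧ ∀ c ∈ U.V, ∀ r ∈ R, r ≠ 0 → U.HasRadius c r := by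
  have := hW.to_subtype
  have := hR.to_subtype
  have hne : Nonempty W := by
    obtain ⟨w, hw⟩ := hS.infinite.nonempty
    exact ⟨⟨w, hw.1⟩⟩
  let D : (W × W) ⊕ (W × R) → Set {T : FloppyGraph α // T.Roomy M W} := fun i =>
    Sum.elim
      (fun p => {T | p.1.1 ∈ T.1.V → p.2.1 ∈ T.1.V → T.1.E p.1.1 p.2.1})
      (fun p => {T | p.1.1 ∈ T.1.V → p.2.1 ≠ 0 → T.1.HasRadius p.1.1 p.2.1}) i
  obtain ⟨s, hs, hs0, hsD⟩ := exists_seq_of_dense D (by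
    rintro (⟨⟨u, hu⟩, v, hv⟩ | ⟨⟨u, hu⟩, r, hr⟩) ⟨T, hT⟩
    · by_cases h : u ∈ T.V ∧ v ∈ T.V
      · obtain ⟨U, h1, h2, h3⟩ := hT.exists_adj hM hinf hmon hdense h.1 h.2
        exact ⟨⟨U, h2⟩, h1, fun _ _ => h3⟩
      · exact ⟨⟨T, hT⟩, le_rfl, fun h1 h2 => absurd ⟨h1, h2⟩ h⟩
    · by_cases h : u ∈ T.V ∧ r ≠ 0
      · obtain ⟨U, h1, h2, h3⟩ := hT.exists_sphere hM hinf hmon h.1 (hRM hr) h.2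
        exact ⟨⟨U, h2⟩, h1, fun _ _ => h3⟩
      · exact ⟨⟨T, hT⟩, le_rfl, fun h1 h2 => absurd ⟨h1, h2⟩ h⟩) ⟨S, hS⟩
  obtain ⟨U, hU, hUV, hUA, hUF⟩ := exists_full_union (fun n => (s n).1)
    (directed_of_isDirected_le (fun i j h => hs h)) (fun n => (s n).2.adapted) (by
      intro n u hu v hv
      obtain ⟨m, hm, h⟩ := hsD (Sum.inl (⟨u, (s n).2.subset hu⟩, ⟨v, (s n).2.subset hv⟩)) n
      exact ⟨m, h ((hs hm).1 hu) ((hs hm).1 hv)⟩)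
  refine ⟨U, ?_, hUA, ?_, hUF, ?_⟩
  · have := hU 0
    rwa [hs0] at this
  · rw [hUV]
    exact Set.iUnion_subset fun n => (s n).2.subset
  · intro c hc r hr hr0
    obtain ⟨n, hn⟩ := Set.mem_iUnion.1 (hUV ▸ hc)
    obtain ⟨m, hm, h⟩ := hsD (Sum.inr (⟨c, (s n).2.subset hn⟩, ⟨r, hr⟩)) n
    exact (h ((hs hm).1 hn) hr0).mono (hU m)

/-- The one-point graph. -/
theorem exists_point (a : α) {M : Set ℝ} (h0 : 0 ∈ M) : ∃ S : FloppyGraph α, S.V = {a} ∧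
    S.Adapted M ∧ S.Full := by
  refine ⟨{ V := {a}
            E := fun u v => u = a ∧ v = a
            ρ := fun _ _ => 0
            mem_left := fun h => h.1
            E_refl := fun h => ⟨h, h⟩
            E_symm := fun h => ⟨h.2, h.1⟩
            ρ_symm := fun _ _ => rfl
            ρ_self := fun _ => rfl
            ρ_pos := fun hu hv h => absurd (hu.trans hv.symm) h
            ρ_tri := fun _ _ _ => by simp
            floppy := fun hu hv h => absurd ⟨hu, hv⟩ h }, rfl, ⟨fun _ => h0, ?_, ?_⟩,
            fun u hu v hv => ⟨hu, hv⟩⟩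
  · rintro c z ⟨rfl, rfl⟩ h
    exact absurd rfl h
  · rintro c u v w s ⟨rfl, rfl⟩ ⟨-, rfl⟩ -  - - -
    exact Or.inl rfl

theorem Adapted.exists_banakh {α : Type} {M : Set ℝ} {U : FloppyGraph α} (hA : U.Adapted M)
    (hF : U.Full) (hne : U.V.Nonempty)
    (hR : ∀ c ∈ U.V, ∀ r ∈ M, r ≠ 0 → U.HasRadius c r) :
    ∃ (X : Type) (_ : MetricSpace X), IsBanakhSpace X ∧ distanceSet X = M := by
  let m : MetricSpace U.V :=
    { dist := fun u v => U.ρ u v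
      dist_self := fun u => U.ρ_self u.2
      dist_comm := fun u v => U.ρ_symm u.2 v.2
      dist_triangle := fun u v w => U.ρ_tri u.2 v.2 w.2
      eq_of_dist_eq_zero := fun {u v} h => by
        by_contra hne
        exact (U.ρ_pos u.2 v.2 (fun e => hne (Subtype.ext e))).ne' h }
  have sphere : ∀ c : U.V, ∀ r ∈ M, r ≠ 0 → ∃ x y : U.V, U.ρ c x = r ∧ U.ρ c y = r ∧
      U.ρ x y = 2 * r := by
    intro c r hr hr0
    obtain ⟨z, hz, hzc, hrz⟩ := hR c c.2 r hr hr0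
    obtain ⟨x, y, h1, h2, -, h4, h5, h6⟩ := hA.exists_sphere hz hzc r hr hr0 hrz
    exact ⟨⟨x, U.mem_right h1⟩, ⟨y, U.mem_right h2⟩, h4, h5, h6⟩
  have hdist : distanceSet U.V = M := by
    ext r
    constructor
    · rintro ⟨x, y, rfl⟩
      exact hA.length_mem (hF x x.2 y y.2)
    · intro hr
      obtain ⟨c, hc⟩ := hne
      by_cases hr0 : r = 0
      · exact ⟨⟨c, hc⟩, ⟨c, hc⟩, by rw [dist_self, hr0]⟩
      · obtain ⟨x, y, h, -⟩ := sphere ⟨c, hc⟩ r hr hr0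
        exact ⟨⟨c, hc⟩, x, h⟩
  refine ⟨U.V, m, ?_, hdist⟩
  intro c r hr
  rw [hdist] at hr
  by_cases hr0 : r = 0
  · subst hr0
    exact ⟨c, c, by simp, by simp⟩
  obtain ⟨x, y, h1, h2, h3⟩ := sphere c r hr hr0
  refine ⟨x, y, ?_, h3⟩
  have hxy : x ≠ y := by
    rintro rfl
    rw [U.ρ_self x.2] at h3
    exact hr0 (by linarith)
  ext z
  simp only [Metric.mem_sphere, Set.mem_insert_iff, Set.mem_singleton_iff]
  have hcomm : ∀ z : U.V, dist z c = U.ρ c z := fun z => U.ρ_symm z.2 c.2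
  rw [hcomm]
  constructor
  · intro hz
    rcases hA.sphere_le_two (hF c c.2 z z.2) (hF c c.2 x x.2) (hF c c.2 y y.2) hz h1 h2 with
      h | h | h
    · exact Or.inl (Subtype.ext h)
    · exact Or.inr (Subtype.ext h)
    · exact absurd (Subtype.ext h) hxy
  · rintro (rfl | rfl)
    exacts [h1, h2]

end FloppyGraph

/-! ### The final construction. -/

namespace FloppyGraph

/-- The real numbers serve merely as a supply of names for vertices: a countable graph leaves
infinitely many free, and countably many of these give the room. -/
theorem exists_full_of_countable {M : Set ℝ} {S : FloppyGraph ℝ} (hS : S.Adapted M)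
    (hV : S.V.Countable) (hM : M ⊆ Set.Ici 0) (hinf : M.Infinite)
    (hmon : ∀ r ∈ M, IsMonoidSet (M ∩ ratMul {r}) ∧ IsFloppySet (M ∩ ratMul {r}))
    (hdense : ∀ B ⊆ M, Cardinal.mk B < Cardinal.mk M → ∀ a b : ℝ, 0 ≤ a → a < b →
      ∃ t ∈ M, a < t ∧ t < b ∧ t ∉ ratMul B)
    (hfew : ∃ B ⊆ M, Cardinal.mk B < Cardinal.mk M ∧ ∀ u v, S.E u v → S.ρ u v ∈ ratMul B)
    {R : Set ℝ} (hR : R.Countable) (hRM : R ⊆ M) :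
    ∃ U, S ≤ U ∧ U.Adapted M ∧ U.V.Countable ∧ U.Full ∧
      ∀ c ∈ U.V, ∀ r ∈ R, r ≠ 0 → U.HasRadius c r := by
  have hinf' : (S.Vᶜ).Infinite := by
    intro h
    refine Cardinal.not_countable_real ?_
    rw [← Set.union_compl_self S.V]
    exact hV.union h.countable
  set N : Set ℝ := Set.range fun n => (hinf'.natEmbedding _ n : ℝ) with hN
  have hNs : N ⊆ S.Vᶜ := by
    rintro _ ⟨n, rfl⟩
    exact (hinf'.natEmbedding _ n).2
  have hNinf : N.Infinite := Set.infinite_range_of_injective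
    (Subtype.val_injective.comp (hinf'.natEmbedding _).injective)
  have hroomy : S.Roomy M (S.V ∪ N) := ⟨hS, Set.subset_union_left,
    hNinf.mono fun p hp => ⟨Or.inr hp, hNs hp⟩, hfew⟩
  have hW : (S.V ∪ N).Countable := hV.union (Set.countable_range _)
  obtain ⟨U, h1, h2, h3, h4, h5⟩ := hroomy.exists_full hM hinf hmon hdense hW hR hRM
  exact ⟨U, h1, h2, hW.mono h3, h4, h5⟩

theorem Adapted.few_of_countable {M : Set ℝ} {S : FloppyGraph ℝ} (hS : S.Adapted M)
    (hV : S.V.Countable) (hM : Cardinal.aleph0 < Cardinal.mk M) :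
    ∃ B ⊆ M, Cardinal.mk B < Cardinal.mk M ∧ ∀ u v, S.E u v → S.ρ u v ∈ ratMul B := by
  refine ⟨M ∩ Set.image2 S.ρ S.V S.V, Set.inter_subset_left, lt_of_le_of_lt ?_ hM, ?_⟩
  · exact Cardinal.le_aleph0_iff_set_countable.2
      ((hV.image2 hV S.ρ).mono Set.inter_subset_right)
  · intro u v h
    exact ⟨1, _, ⟨hS.length_mem h, u, S.mem_left h, v, S.mem_right h, rfl⟩, by simp⟩

end FloppyGraph

open FloppyGraph in
theorem theoremt (M : Set ℝ) (hM : M ⊆ Set.Ici 0)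
    (hcard : Cardinal.mk M ≤ Cardinal.aleph 1)
    (hmonoid : ∀ r ∈ M, IsMonoidSet (M ∩ ratMul {r}) ∧ IsFloppySet (M ∩ ratMul {r}))
    (hdense : ∀ B : Set ℝ, B ⊆ M → Cardinal.mk B < Cardinal.mk M →
      Set.Ici 0 ⊆ closure (indecomposables M \ (ratMul B + ratMul B))) :
    ∃ (X : Type) (_ : MetricSpace X), IsBanakhSpace X ∧ distanceSet X = M := by
  rcases M.eq_empty_or_nonempty with rfl | ⟨m, hm⟩
  · refine ⟨Empty, inferInstance, fun c => c.elim, ?_⟩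
    ext r
    simp [distanceSet]
  have h0 : (0 : ℝ) ∈ M := (hmonoid m hm).1.1.1
  -- A finite `M` is closed, so density with `B = ∅` would give `[0, ∞) ⊆ M`.
  have hinf : M.Infinite := by
    intro hfin
    have hmk : Cardinal.mk (∅ : Set ℝ) < Cardinal.mk M := by
      have : Nonempty M := ⟨⟨m, hm⟩⟩
      rw [Cardinal.mk_eq_zero]
      exact Cardinal.mk_ne_zero M |>.bot_lt
    have hsub : Set.Ici (0 : ℝ) ⊆ M := by
      refine (hdense ∅ (Set.empty_subset _) hmk).trans ?_
      refine closure_minimal ?_ hfin.isClosed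
      rintro r ⟨hr, -⟩
      exact hr.1.1
    exact Set.Ici_infinite 0 (hfin.subset hsub)
  have hM' : Cardinal.aleph0 ≤ Cardinal.mk M := by
    have := hinf.to_subtype
    exact Cardinal.aleph0_le_mk M
  have hd : ∀ B ⊆ M, Cardinal.mk B < Cardinal.mk M → ∀ a b : ℝ, 0 ≤ a → a < b →
      ∃ t ∈ M, a < t ∧ t < b ∧ t ∉ ratMul B := by
    intro B hB hBc a b ha hab
    -- With `0` added, `ℚB` is contained in the sumset that density avoids.
    have hc := hdense (insert 0 B) (Set.insert_subset h0 hB)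
      (Cardinal.mk_insert_le.trans_lt (Cardinal.add_lt_of_lt hM' hBc
        (Cardinal.one_lt_aleph0.trans_le hM')))
    have hmid : (a + b) / 2 ∈ Set.Ici (0 : ℝ) := by
      simp only [Set.mem_Ici]; linarith
    obtain ⟨t, ht, ht', hn⟩ := mem_closure_iff.1 (hc hmid) (Set.Ioo a b) isOpen_Ioo
      ⟨by linarith, by linarith⟩
    refine ⟨t, ht'.1.1, ht.1, ht.2, fun hmem => hn ?_⟩
    rw [← add_zero t]
    exact Set.add_mem_add (ratMul_mono (Set.subset_insert _ _) hmem)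
      ⟨0, 0, Set.mem_insert _ _, by simp⟩
  obtain ⟨S, hSV, hSA, hSF⟩ := exists_point (0 : ℝ) h0
  have hSc : S.V.Countable := hSV ▸ Set.countable_singleton 0
  have hS0 : (0 : ℝ) ∈ S.V := by simp [hSV]
  rcases hM'.lt_or_eq with hlt | heq
  · let P := {T : FloppyGraph ℝ // T.Adapted M ∧ T.V.Countable ∧ T.Full ∧ (0 : ℝ) ∈ T.V}
    -- Initial segments of `ω₁` are countable, so every stage is a countable graph with countably
    -- many radii to serve.
    let I := (Cardinal.aleph 1).ord.ToType
    have hI : ∀ i : I, (Set.Iio i).Countable := fun i => by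
      have h : Cardinal.mk (Set.Iio i) < Cardinal.mk I := Cardinal.mk_Iio_lt i (by simp [I])
      have h' : Cardinal.mk (Set.Iio i) < Order.succ Cardinal.aleph0 :=
        h.trans_eq ((Cardinal.mk_ord_toType _).trans Cardinal.succ_aleph0.symm)
      exact Cardinal.le_aleph0_iff_set_countable.1 (Order.lt_succ_iff.1 h')
    obtain ⟨g, hg⟩ : ∃ g : I → M, Function.Surjective g := by
      have : Nonempty M := ⟨⟨m, hm⟩⟩
      have hle : Cardinal.mk M ≤ Cardinal.mk I := by rwa [Cardinal.mk_ord_toType]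
      obtain ⟨e⟩ := Cardinal.le_def _ _ |>.1 hle
      exact ⟨Function.invFun e, Function.invFun_surjective e.injective⟩
    obtain ⟨f, hf, hfD⟩ := exists_monotone_of_dense (P := P) hI (by
        intro s hs hne hch
        have := hs.to_subtype
        obtain ⟨U, h1, h2, h3, h4⟩ := exists_full_union (M := M) (fun p : s => p.1.1)
          (fun p q => by
            rcases eq_or_ne p.1 q.1 with h | h
            · exact ⟨p, le_rfl, le_of_eq (congrArg Subtype.val h.symm)⟩
            · rcases hch p.2 q.2 h with h | h
              · exact ⟨q, h, le_rfl⟩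
              · exact ⟨p, le_rfl, h⟩) (fun p => p.1.2.1)
          (fun p u hu v hv => ⟨p, p.1.2.2.2.1 u hu v hv⟩)
        obtain ⟨p₀, hp₀⟩ := hne
        exact ⟨⟨U, h3, h2 ▸ Set.countable_iUnion fun p => p.1.2.2.1, h4,
          (h1 ⟨p₀, hp₀⟩).1 p₀.2.2.2.2⟩,
          fun p hp => h1 ⟨p, hp⟩⟩)
      (fun i => {p : P | ∀ c ∈ p.1.V, ∀ r ∈ (fun j => (g j : ℝ)) '' Set.Iic i, r ≠ 0 →
        p.1.HasRadius c r}) (by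
        rintro i ⟨T, hT, hTc, hTF, hT0⟩
        obtain ⟨U, h1, h2, h3, h4, h5⟩ := exists_full_of_countable hT hTc hM hinf hmonoid hd
          (hT.few_of_countable hTc hlt) (R := (fun j => (g j : ℝ)) '' Set.Iic i)
          (by
            rw [← Set.Iio_insert]
            exact ((hI i).insert i).image _) (by
            rintro _ ⟨j, -, rfl⟩
            exact (g j).2)
        exact ⟨⟨U, h2, h3, h4, h1.1 hT0⟩, h1, h5⟩) ⟨S, hSA, hSc, hSF, hS0⟩
    obtain ⟨U, h1, h2, h3, h4⟩ := exists_full_union (M := M) (fun i => (f i).1)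
      (directed_of_isDirected_le (fun i j h => hf h)) (fun i => (f i).2.1)
      (fun i u hu v hv => ⟨i, (f i).2.2.2.1 u hu v hv⟩)
    obtain ⟨i₀, -⟩ := hg ⟨m, hm⟩
    refine h3.exists_banakh h4 ⟨0, (h1 i₀).1 (f i₀).2.2.2.2⟩ ?_
    intro c hc r hr hr0
    obtain ⟨i, hi⟩ := Set.mem_iUnion.1 (h2 ▸ hc)
    obtain ⟨j, hj⟩ := hg ⟨r, hr⟩
    -- By stage `max i j` the point `c` is present and the radius with index `j` is due.
    refine HasRadius.mono (h1 (max i j)) (hfD (max i j) c ((hf (le_max_left i j)).1 hi) r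
      ⟨j, le_max_right i j, congrArg Subtype.val hj⟩ hr0)
  · have hMc : M.Countable := Cardinal.le_aleph0_iff_set_countable.1 heq.symm.le
    obtain ⟨U, h1, h2, -, h4, h5⟩ := exists_full_of_countable hSA hSc hM hinf hmonoid hd
      ⟨{0}, by simpa using h0, by
        rw [← heq, Cardinal.mk_singleton]; exact Cardinal.one_lt_aleph0, fun u v h => by
        have hu := S.mem_left h
        have hv := S.mem_right h
        rw [hSV, Set.mem_singleton_iff] at hu hv
        subst hu
        subst hv
        rw [S.ρ_self hS0]
        exact mem_ratMul_self 0⟩ hMc subset_rfl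
    exact h2.exists_banakh h4 ⟨0, h1.1 hS0⟩ h5
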